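/- **Setting.** Let $e_k(x)=\sqrt2\,\sin(k\pi x)$, $k\ge1$, be the eigenfunctions of the Dirichlet Laplacian $\Delta$ on $L^2(0,1)$. For $\alpha>0$ and $r\ge2$, let $\mathcal B_{\alpha,r}$ be the space of all $\varphi\in L^2(0,1)$ in the domain of $(-\Delta)^\alpha$ with $(-\Delta)^\alpha\varphi\in L^r(0,1)$, with norm $\|\varphi\|_{\mathcal B_{\alpha,r}}=\|(-\Delta)^\alpha\varphi\|_{L^r(0,1)}$, and put $\|\varphi\|_{\mathcal B_{\alpha,r}}=\infty$ for the other $\varphi\in L^2(0,1)$. For a path $y:[0,1]\to L^2(0,1)$ and $\theta\in\mathbb R$ let $$\mathcal N[y;\mathcal C^\theta(\mathcal B_{\alpha,r})]=\sup_{0\le s<t\le1}\frac{\|y_t-y_s\|_{\mathcal B_{\alpha,r}}}{|t-s|^\theta}\in[0,\infty].$$ Fix $\eta>0$ and non-negative numbers $(\lambda_k)_{k\ge1}$ with $\sum_{k\ge1}\lambda_k k^{4\eta}<\infty$. For real processes $(X^k)_{k\ge1}$ on $[0,1]$, write $$\mathbf W(X^\cdot)_t=\sum_{k\ge1}\sqrt{\lambda_k}\,X^k_t\,e_k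 ,\qquad t\in[0,1],$$ with convergence in $L^2(\Omega;L^2(0,1))$ for each $t$; this defines $\mathbf W(X^\cdot)_t$ up to a null set. **Proposition 4.4.** Let $(\beta^n)_{n\ge1}$ be centered real processes on $[0,1]$ and $\beta$ a standard Brownian motion, all on one probability space $(\Omega,\mathcal F,P)$, such that 1. for every integer $p\ge1$ there is a constant $C_p$ with $E\big[|\beta^n_t-\beta^n_s|^{2p}\big]\le C_p|t-s|^p$ for all $s,t\in[0,1]$ and all $n\ge1$; 2. for some $\nu>0$ and every integer $p\ge1$ there is a constant $C_p$ with $\sup_{t\in[0,1]}E\big[|\beta^n_t-\beta_t|^{2p}\big]\le C_p\,n^{-\nu p}$ for all $n\ge1$. On some probability space $(\Omega',\mathcal F',P')$ let $\beta^{n,k}$ and $\beta^k$ ($n,k\ge1$) be processes on $[0,1]$ such that, for each $n\ge1$, the pairs $(\beta^{n,k},\beta^k)$, $k\ge1$, are independent copies of $(\beta^n,\beta)$. Then: - Each of the processes $\mathbf W(\beta^{n,\cdot})$, $n\ge1$, and $\mathbf W(\beta^\cdot)$ is well defined and has a version all of whose paths are continuous in $L^2(0,1)$ and, for every integer $p\ge1$,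 continuous with values in $\mathcal B_{\eta,2p}$. - For all versions of $\mathbf W(\beta^{n,\cdot})$, $n\ge1$, and $\mathbf W(\beta^\cdot)$ whose paths are almost surely continuous in $L^2(0,1)$, for every integer $p\ge1$ and every $\varepsilon>0$, $$\mathcal N\big[\mathbf W(\beta^{n,\cdot})-\mathbf W(\beta^\cdot);\mathcal C^{\frac12-\varepsilon}(\mathcal B_{\eta,2p})\big]\xrightarrow[n\to\infty]{}0\qquad\text{almost surely.}$$ -/

import Mathlib

open MeasureTheory ProbabilityTheory Filter Topology
open scoped NNReal ENNReal

namespace HeatNoise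

noncomputable section

/-- The time interval `[0,1]`. -/
abbrev UnitTime : Type := Set.Icc (0 : ℝ≥0) 1

/-- Lebesgue measure on the space interval `(0,1)`. -/
abbrev spaceMeasure : Measure ℝ := volume.restrict (Set.Ioo (0 : ℝ) 1)

/-- The space `L²(0,1)`. -/
abbrev L2 : Type := Lp ℝ 2 spaceMeasure

/-- The Dirichlet eigenfunctions `x ↦ √2 sin((k+1)πx)`. Modes are numbered from `0` here, so that
the index `k : ℕ` stands for the `(k+1)`-st eigenfunction. -/
def eigenfun (k : ℕ) (x : ℝ) : ℝ := √2 * Real.sin ((k + 1) * Real.pi * x)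

theorem memLp_eigenfun (k : ℕ) : MemLp (eigenfun k) 2 spaceMeasure := by
  refine MemLp.of_bound (C := √2) ?_ (Eventually.of_forall fun x => ?_)
  · exact Continuous.aestronglyMeasurable (by unfold eigenfun; fun_prop)
  · rw [eigenfun, norm_mul, Real.norm_eq_abs, Real.norm_eq_abs, abs_of_nonneg (Real.sqrt_nonneg 2)]
    exact mul_le_of_le_one_right (Real.sqrt_nonneg 2) (Real.abs_sin_le_one _)

/-- The Dirichlet eigenfunctions as elements of `L²(0,1)`. -/
def e (k : ℕ) : L2 := (memLp_eigenfun k).toLp (eigenfun k)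

/-- The eigenvalues `((k+1)π)²` of `-Δ`, for the Dirichlet Laplacian `Δ` on `(0,1)`. -/
def eigenvalue (k : ℕ) : ℝ := ((k + 1) * Real.pi) ^ 2

/-- `ψ = (-Δ)^α φ` in `L²(0,1)`, the fractional power being the one of the spectral calculus: on
the `k`-th mode, `(-Δ)^α` multiplies by the `α`-th power of the eigenvalue. Since the `e k` form a
Hilbert basis, there is at most one such `ψ`; for `α ≥ 0` there is one exactly when `φ` lies
in the domain of `(-Δ)^α` in `L²(0,1)`. -/
def IsFracLaplacian (α : ℝ) (φ ψ : L2) : Prop :=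
  ∀ k, inner ℝ (e k) ψ = eigenvalue k ^ α * inner ℝ (e k) φ

/-- The norm `‖φ‖ = ‖(-Δ)^α φ‖_{L^p(0,1)}` of the fractional Sobolev space of order `α ≥ 0` based
on `L^p(0,1)`, `p ≥ 2`, as a function on `L²(0,1)` with value `∞` outside that space: if `φ` is not
in the domain of `(-Δ)^α`, the infimum is over the empty set, and otherwise it is over the
single element `ψ = (-Δ)^α φ`. -/
def sobolevNorm (α : ℝ) (p : ℝ≥0∞) (φ : L2) : ℝ≥0∞ :=
  ⨅ (ψ : L2) (_ : IsFracLaplacian α φ ψ), eLpNorm ψ p spaceMeasure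

/-- The path `y : [0,1] → L²(0,1)` takes its values in the fractional Sobolev space of order `α`
based on `L^p(0,1)` and is continuous for the norm of that space. -/
def IsContinuousSobolevPath (α : ℝ) (p : ℝ≥0∞) (y : UnitTime → L2) : Prop :=
  (∀ t, sobolevNorm α p (y t) < ∞) ∧
    ∀ t, Tendsto (fun s => sobolevNorm α p (y s - y t)) (𝓝 t) (𝓝 0)

/-- The Hölder seminorm `sup_{s<t} ‖y_t - y_s‖ / |t-s|^θ` of a path on `[0,1]`, with respect to the
norm of the fractional Sobolev space of order `α` based on `L^p(0,1)`. -/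
def holderSeminorm (θ α : ℝ) (p : ℝ≥0∞) (y : UnitTime → L2) : ℝ≥0∞ :=
  ⨆ (s : UnitTime) (t : UnitTime) (_ : s < t),
    sobolevNorm α p (y t - y s) / ENNReal.ofReal (((t : ℝ) - (s : ℝ)) ^ θ)

/-- `V` is (a version of) the process `t ↦ ∑ₖ √(λₖ) Xᵏ_t eₖ`: at every time `t ∈ [0,1]`, the series
converges to `V t` in `L²(Ω; L²(0,1))`. This determines each `V t` up to a null set. -/
def IsNoise {Ω : Type*} [MeasurableSpace Ω] (P : Measure Ω) (lam : ℕ → ℝ)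
    (X : ℕ → UnitTime → Ω → ℝ) (V : UnitTime → Ω → L2) : Prop :=
  ∀ t, AEStronglyMeasurable (V t) P ∧
    Tendsto (fun N : ℕ =>
        ∫⁻ ω, ‖V t ω - ∑ k ∈ Finset.range N, (√(lam k) * X k t ω) • e k‖ₑ ^ 2 ∂P)
      atTop (𝓝 0)

end

end HeatNoise

/-! ### Even moments of sums of independent centered variables. -/

namespace HeatNoise

/-! Applying `(-Δ)^η` to the noise multiplies the k-th weight by the eigenvalue to the power 2η.
This gives a noise of the same form with weights `fracWeight η lam`, which are still summable.
Everything thus reduces to Hölder estimates in `L^{2q}(0,1)` for a noise with summable weights. Only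
upper bounds on `sobolevNorm` are needed, and any ψ satisfying `IsFracLaplacian` provides one.

For independent centered ξ_k whose 2j-th moments are at most C_j h^j, the 2q-th moment of ∑ c_k ξ_k
is at most a constant times (h ∑ c_k²)^q (`integral_even_pow_sum_le`). At a fixed point x take c_k =
√λ_k e_k(x), use e_k(x)² ≤ 2, and integrate in x. The 2q-th moment of the `L^{2q}` norm of the
random series is then O((h ∑ λ_k)^q) (`lintegral_spaceNorm_sum_pow_le`), and Fatou carries the bound
to the infinite series.

For a single noise the increments have scale h = |t-s|, so dyadic chaining (`limit_holder_le`,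
`exists_continuous_modification`) gives continuous versions. For the difference of the two noises
both hypotheses apply and h = min(|t-s|, n^(-ν)). Hence h^q ≤ n^(-νδq) |t-s|^((1-δ)q): a small part
of the time regularity buys decay in n. For q large the chaining still reaches the required Hölder
exponent, and the 2q-th moments of the Hölder constants are summable in n, so these constants tend
to 0 almost surely (`ae_tendsto_holderConst`).

Arbitrary continuous versions agree almost surely, at all times at once, with the constructed ones,
for which the image under `(-Δ)^η` is known. -/

theorem exists_add_pow_even_le (i : ℕ) : ∃ T : ℝ, 0 ≤ T ∧ ∀ x y : ℝ,
    (x + y) ^ (2 * (i + 1)) ≤ x ^ (2 * (i + 1)) + 2 * (i + 1) * (x ^ (2 * i + 1) * y)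
      + T * (x ^ (2 * i) * y ^ 2 + y ^ (2 * (i + 1))) := by
  -- The induction multiplies the previous bound by (x + y)². The term linear in y keeps its exact
  -- coefficient, because it must vanish in expectation; all other terms only need an upper bound.
  induction i with
  | zero => exact ⟨1, zero_le_one, fun x y => by norm_num; nlinarith [sq_nonneg y]⟩
  | succ i ih =>
    obtain ⟨T, hT, h⟩ := ih
    -- The three summands pay for x^(2i+2) y², for x^(2i+1) y³, and for (x + y)² times the old
    -- remainder.
    refine ⟨(4 * i + 5) + (2 * i + 2) + 6 * T, by positivity, fun x y => ?_⟩
    set a := x ^ 2 with ha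
    set b := y ^ 2 with hb
    have ha0 : 0 ≤ a := sq_nonneg x
    have hb0 : 0 ≤ b := sq_nonneg y
    have h1 : a ^ i * b ^ 2 ≤ a ^ (i + 1) * b + b ^ (i + 2) := by
      rcases le_total a b with hab | hab
      · have : a ^ i * b ^ 2 ≤ b ^ i * b ^ 2 := by gcongr
        have : 0 ≤ a ^ (i + 1) * b := by positivity
        nlinarith [pow_add b i 2]
      · have : a ^ i * (b * b) ≤ a ^ i * (a * b) := by gcongr
        have : 0 ≤ b ^ (i + 2) := by positivity
        nlinarith [pow_succ a i]
    have h2 : a * b ^ (i + 1) ≤ a ^ (i + 1) * b + b ^ (i + 2) := by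
      rcases le_total a b with hab | hab
      · have : a * b ^ (i + 1) ≤ b * b ^ (i + 1) := by gcongr
        have : 0 ≤ a ^ (i + 1) * b := by positivity
        nlinarith [pow_succ b (i + 1)]
      · have : (a * b) * b ^ i ≤ (a * b) * a ^ i := by gcongr
        have : 0 ≤ b ^ (i + 2) := by positivity
        nlinarith [pow_succ a i, pow_succ b i]
    have h3 : x ^ (2 * i + 1) * y ^ 3 ≤ a ^ (i + 1) * b + b ^ (i + 2) := by
      have e1 : x ^ (2 * i + 1) * y ^ 3 = (a ^ i * b) * (x * y) := by
        rw [ha, hb, ← pow_mul]; ring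
      have e2 : x * y ≤ (a + b) / 2 := by nlinarith [sq_nonneg (x - y)]
      have e3 : (a ^ i * b) * (x * y) ≤ (a ^ i * b) * ((a + b) / 2) := by gcongr
      have : 0 ≤ b ^ (i + 2) := by positivity
      nlinarith [pow_succ a i]
    have h4 : (x + y) ^ 2 ≤ 2 * (a + b) := by nlinarith [sq_nonneg (x - y)]
    have h5 : (x + y) ^ 2 * (a ^ i * b + b ^ (i + 1))
        ≤ 6 * (a ^ (i + 1) * b + b ^ (i + 2)) := by
      have e1 : (x + y) ^ 2 * (a ^ i * b + b ^ (i + 1))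
          ≤ 2 * (a + b) * (a ^ i * b + b ^ (i + 1)) := by gcongr
      have e2 : 2 * (a + b) * (a ^ i * b + b ^ (i + 1)) = 2 * (a ^ (i + 1) * b + a ^ i * b ^ 2
          + a * b ^ (i + 1) + b ^ (i + 2)) := by ring
      nlinarith
    have h6 : 0 ≤ b ^ (i + 2) := by positivity
    calc (x + y) ^ (2 * (i + 1 + 1)) = (x + y) ^ 2 * (x + y) ^ (2 * (i + 1)) := by ring
      _ ≤ (x + y) ^ 2 * (x ^ (2 * (i + 1)) + 2 * (i + 1) * (x ^ (2 * i + 1) * y)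
            + T * (x ^ (2 * i) * y ^ 2 + y ^ (2 * (i + 1)))) :=
          mul_le_mul_of_nonneg_left (h x y) (sq_nonneg _)
      _ = x ^ (2 * (i + 1 + 1)) + 2 * (i + 1 + 1) * (x ^ (2 * (i + 1) + 1) * y)
            + (4 * i + 5) * (a ^ (i + 1) * b) + (2 * i + 2) * (x ^ (2 * i + 1) * y ^ 3)
            + T * ((x + y) ^ 2 * (a ^ i * b + b ^ (i + 1))) := by
          rw [ha, hb]; simp only [← pow_mul]; ring
      _ ≤ x ^ (2 * (i + 1 + 1)) + 2 * (i + 1 + 1) * (x ^ (2 * (i + 1) + 1) * y)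
            + (4 * i + 5) * (a ^ (i + 1) * b + b ^ (i + 2))
            + (2 * i + 2) * (a ^ (i + 1) * b + b ^ (i + 2))
            + T * (6 * (a ^ (i + 1) * b + b ^ (i + 2))) := by
          gcongr
          linarith
      _ = _ := by
          rw [ha, hb]; push_cast; simp only [← pow_mul]; ring

theorem integrable_pow_of_memLp {Ω : Type*} [MeasurableSpace Ω] {P : Measure Ω}
    [IsFiniteMeasure P] {f : Ω → ℝ} {n : ℕ} (hf : MemLp f n P) :
    Integrable (fun ω => f ω ^ n) P := by
  have h := hf.integrable_norm_pow'
  refine (integrable_norm_iff (hf.1.pow n)).1 ?_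
  simpa [norm_pow] using h

/-- The constant in the binomial bound `exists_add_pow_even_le`. -/
noncomputable def addPowConst (i : ℕ) : ℝ := (exists_add_pow_even_le i).choose

/-- The constant in the moment bound for sums of independent centered variables whose `2j`-th
moments are controlled by `C j`. -/
noncomputable def momentConst (C : ℕ → ℝ) : ℕ → ℝ
  | 0 => 1
  | i + 1 => 2 * addPowConst i * (momentConst C i * C 1 + C (i + 1))

theorem addPowConst_nonneg (i : ℕ) : 0 ≤ addPowConst i := (exists_add_pow_even_le i).choose_spec.1

theorem add_pow_even_le (i : ℕ) (x y : ℝ) :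
    (x + y) ^ (2 * (i + 1)) ≤ x ^ (2 * (i + 1)) + 2 * (i + 1) * (x ^ (2 * i + 1) * y)
      + addPowConst i * (x ^ (2 * i) * y ^ 2 + y ^ (2 * (i + 1))) :=
  (exists_add_pow_even_le i).choose_spec.2 x y

theorem momentConst_nonneg {C : ℕ → ℝ} (hC : ∀ j, 0 ≤ C j) (i : ℕ) : 0 ≤ momentConst C i := by
  induction i with
  | zero => exact zero_le_one
  | succ i ih =>
    have := hC 1
    have := hC (i + 1)
    have := addPowConst_nonneg i
    simp only [momentConst]
    positivity

/-- Write the right side as (x + y)(x + y)^i and bound the second factor below by x^i and by y^i.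
The surplus absorbs the remainder of the moment induction; its factor 1/2 explains the 2 in
`momentConst`. -/
theorem pow_succ_add_le {x y : ℝ} (hx : 0 ≤ x) (hy : 0 ≤ y) (i : ℕ) :
    x ^ (i + 1) + (x ^ i * y + y ^ (i + 1)) / 2 ≤ (x + y) ^ (i + 1) := by
  have h1 : x ^ i ≤ (x + y) ^ i := by gcongr; linarith
  have h2 : y ^ i ≤ (x + y) ^ i := by gcongr; linarith
  have h3 : x * x ^ i ≤ x * (x + y) ^ i := by gcongr
  have h4 : y * x ^ i ≤ y * (x + y) ^ i := by gcongr
  have h5 : y * y ^ i ≤ y * (x + y) ^ i := by gcongr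
  rw [pow_succ, pow_succ, pow_succ]
  linarith

/-- One step of the induction for `integral_even_pow_sum_le`. -/
theorem integral_add_pow_even_le {Ω : Type*} [MeasurableSpace Ω] {P : Measure Ω}
    [IsProbabilityMeasure P] {S Y : Ω → ℝ} (hind : IndepFun S Y P)
    (hS : ∀ n : ℕ, MemLp S n P) (hY : ∀ n : ℕ, MemLp Y n P) (hY0 : ∫ ω, Y ω ∂P = 0) (i : ℕ) :
    ∫ ω, (S ω + Y ω) ^ (2 * (i + 1)) ∂P ≤ ∫ ω, S ω ^ (2 * (i + 1)) ∂P
      + addPowConst i * ((∫ ω, S ω ^ (2 * i) ∂P) * (∫ ω, Y ω ^ 2 ∂P)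
        + ∫ ω, Y ω ^ (2 * (i + 1)) ∂P) := by
  have hindp : ∀ a b : ℕ, IndepFun (fun ω => S ω ^ a) (fun ω => Y ω ^ b) P := fun a b =>
    hind.comp (φ := fun x => x ^ a) (ψ := fun x => x ^ b) (by fun_prop) (by fun_prop)
  have hint : ∀ a b : ℕ, Integrable (fun ω => S ω ^ a * Y ω ^ b) P := fun a b =>
    (hindp a b).integrable_mul (integrable_pow_of_memLp (hS a)) (integrable_pow_of_memLp (hY b))
  have heq : ∀ a b : ℕ, ∫ ω, S ω ^ a * Y ω ^ b ∂P = (∫ ω, S ω ^ a ∂P) * ∫ ω, Y ω ^ b ∂P :=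
    fun a b => (hindp a b).integral_fun_mul_eq_mul_integral
      (integrable_pow_of_memLp (hS a)).1 (integrable_pow_of_memLp (hY b)).1
  have hint1 : Integrable (fun ω => S ω ^ (2 * i + 1) * Y ω) P := by simpa using hint (2 * i + 1) 1
  -- Independence and centering remove the only term of first order in Y, so the variances add up.
  have heq1 : ∫ ω, S ω ^ (2 * i + 1) * Y ω ∂P = 0 := by
    have := heq (2 * i + 1) 1
    simpa [hY0] using this
  have hS' := integrable_pow_of_memLp (hS (2 * (i + 1)))
  have hY' := integrable_pow_of_memLp (hY (2 * (i + 1)))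
  have hA : Integrable (fun ω => S ω ^ (2 * (i + 1))
      + 2 * (i + 1) * (S ω ^ (2 * i + 1) * Y ω)) P := hS'.add (hint1.const_mul _)
  have hB : Integrable (fun ω => addPowConst i
      * (S ω ^ (2 * i) * Y ω ^ 2 + Y ω ^ (2 * (i + 1)))) P := ((hint _ _).add hY').const_mul _
  calc ∫ ω, (S ω + Y ω) ^ (2 * (i + 1)) ∂P
      ≤ ∫ ω, (S ω ^ (2 * (i + 1)) + 2 * (i + 1) * (S ω ^ (2 * i + 1) * Y ω)
        + addPowConst i * (S ω ^ (2 * i) * Y ω ^ 2 + Y ω ^ (2 * (i + 1)))) ∂P := by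
        refine integral_mono (integrable_pow_of_memLp ((hS _).add (hY _))) ?_
          fun ω => add_pow_even_le i _ _
        exact hA.add hB
    _ = _ := by
        rw [integral_add hA hB, integral_add hS' (hint1.const_mul _), integral_const_mul,
          integral_const_mul, integral_add (hint _ _) hY', heq1, heq]
        ring

/-- Even moments of sums of independent centered variables are controlled by the variance. -/
theorem integral_even_pow_sum_le {ι Ω : Type*} [MeasurableSpace Ω] {P : Measure Ω}
    [IsProbabilityMeasure P] {ξ : ι → Ω → ℝ} (hind : iIndepFun ξ P)
    (hL : ∀ k (n : ℕ), MemLp (ξ k) n P) (h0 : ∀ k, ∫ ω, ξ k ω ∂P = 0)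
    {C : ℕ → ℝ} (hC : ∀ j, 0 ≤ C j) {h : ℝ} (hh : 0 ≤ h)
    (hm : ∀ k j, 1 ≤ j → ∫ ω, ξ k ω ^ (2 * j) ∂P ≤ C j * h ^ j)
    (c : ι → ℝ) (s : Finset ι) (j : ℕ) :
    ∫ ω, (∑ k ∈ s, c k * ξ k ω) ^ (2 * j) ∂P ≤ momentConst C j * (h * ∑ k ∈ s, c k ^ 2) ^ j := by
  classical
  induction s using Finset.induction_on generalizing j with
  | empty => cases j <;> simp [momentConst]
  | insert a s ha ih =>
    cases j with
    | zero => simp [momentConst]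
    | succ i =>
      have hYL : ∀ k (n : ℕ), MemLp (fun ω => c k * ξ k ω) n P := fun k n => (hL k n).const_mul _
      have hSL : ∀ n : ℕ, MemLp (fun ω => ∑ k ∈ s, c k * ξ k ω) n P := fun n =>
        memLp_finsetSum _ fun k _ => hYL k n
      have hind' : iIndepFun (fun k ω => c k * ξ k ω) P :=
        hind.comp (fun k x => c k * x) (fun k => by fun_prop)
      have hSY : IndepFun (fun ω => ∑ k ∈ s, c k * ξ k ω) (fun ω => c a * ξ a ω) P := by
        have := hind'.indepFun_finsetSum_of_notMem₀
          (fun k => (hYL k 0).1.aemeasurable) ha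
        convert this using 1
        ext ω
        simp
      have hY0 : ∫ ω, c a * ξ a ω ∂P = 0 := by rw [integral_const_mul, h0, mul_zero]
      have hYm : ∀ j, 1 ≤ j → ∫ ω, (c a * ξ a ω) ^ (2 * j) ∂P ≤ C j * (h * c a ^ 2) ^ j := by
        intro j hj
        simp_rw [mul_pow (c a)]
        rw [integral_const_mul]
        calc c a ^ (2 * j) * ∫ ω, ξ a ω ^ (2 * j) ∂P ≤ c a ^ (2 * j) * (C j * h ^ j) := by
              gcongr
              · exact (even_two_mul j).pow_nonneg _
              · exact hm a j hj
          _ = _ := by rw [pow_mul, mul_pow]; ring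
      have hY1 := hYm 1 le_rfl
      have hYi := hYm (i + 1) (by omega)
      rw [mul_one, pow_one] at hY1
      have hs := ih i
      have hs' := ih (i + 1)
      set x := h * ∑ k ∈ s, c k ^ 2 with hx
      set y := h * c a ^ 2 with hy
      have hx0 : 0 ≤ x := mul_nonneg hh (Finset.sum_nonneg fun k _ => sq_nonneg _)
      have hy0 : 0 ≤ y := mul_nonneg hh (sq_nonneg _)
      have hD := momentConst_nonneg hC i
      have hT := addPowConst_nonneg i
      have hC1 := hC 1
      have hCi := hC (i + 1)
      have hsum : h * ∑ k ∈ insert a s, c k ^ 2 = x + y := by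
        rw [Finset.sum_insert ha, hx, hy]; ring
      rw [hsum]
      simp_rw [Finset.sum_insert ha, add_comm (c a * ξ a _)]
      calc _ ≤ _ := integral_add_pow_even_le hSY hSL (hYL a) hY0 i
        _ ≤ momentConst C (i + 1) * x ^ (i + 1) + addPowConst i *
            ((momentConst C i * x ^ i) * (C 1 * y) + C (i + 1) * y ^ (i + 1)) := by
          have : 0 ≤ ∫ ω, (c a * ξ a ω) ^ 2 ∂P := integral_nonneg fun ω => sq_nonneg _
          gcongr
        _ ≤ momentConst C (i + 1) * (x ^ (i + 1) + (x ^ i * y + y ^ (i + 1)) / 2) := by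
          simp only [momentConst]
          have e1 : 0 ≤ addPowConst i * (momentConst C i * C 1) * y ^ (i + 1) := by positivity
          have e2 : 0 ≤ addPowConst i * C (i + 1) * (x ^ i * y) := by positivity
          nlinarith
        _ ≤ _ := mul_le_mul_of_nonneg_left (pow_succ_add_le hx0 hy0 i)
          (momentConst_nonneg hC _)

end HeatNoise

/-! ### Dyadic chaining for a subadditive functional with values in [0, ∞]. -/

namespace HeatNoise

/-- The dyadic point `i / 2 ^ j` of the unit interval. -/
noncomputable def gridPt (j i : ℕ) : UnitTime :=
  ⟨min ((i : ℝ≥0) / 2 ^ j) 1, zero_le, min_le_right _ _⟩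

/-- The index of the last dyadic point of level `j` up to `t`. -/
noncomputable def gridIdx (j : ℕ) (t : UnitTime) : ℕ := ⌊2 ^ j * (t : ℝ)⌋₊

theorem coe_gridPt {j i : ℕ} (hi : i ≤ 2 ^ j) : ((gridPt j i : UnitTime) : ℝ) = i / 2 ^ j := by
  have h : ((i : ℝ≥0) / 2 ^ j) ≤ 1 := by
    rw [div_le_one (by positivity)]
    exact_mod_cast hi
  simp [gridPt, min_eq_left h]

theorem gridPt_succ_two_mul (j i : ℕ) : gridPt (j + 1) (2 * i) = gridPt j i := by
  have : ((2 * i : ℕ) : ℝ≥0) / 2 ^ (j + 1) = i / 2 ^ j := by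
    push_cast
    rw [pow_succ, mul_comm (2 : ℝ≥0), mul_div_mul_right _ _ two_ne_zero]
  simp only [gridPt, this]

theorem gridIdx_le (j : ℕ) (t : UnitTime) : (gridIdx j t : ℝ) ≤ 2 ^ j * (t : ℝ) :=
  Nat.floor_le (by positivity)

theorem lt_gridIdx_add_one (j : ℕ) (t : UnitTime) : 2 ^ j * (t : ℝ) < gridIdx j t + 1 :=
  Nat.lt_floor_add_one _

theorem gridIdx_le_two_pow (j : ℕ) (t : UnitTime) : gridIdx j t ≤ 2 ^ j := by
  have h := gridIdx_le j t
  have h1 : (t : ℝ) ≤ 1 := by exact_mod_cast t.2.2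
  have : (2 : ℝ) ^ j * (t : ℝ) ≤ 2 ^ j := mul_le_of_le_one_right (by positivity) h1
  exact_mod_cast h.trans this

theorem abs_gridPt_gridIdx_sub_le (j : ℕ) (t : UnitTime) :
    |((gridPt j (gridIdx j t) : UnitTime) : ℝ) - (t : ℝ)| ≤ (1 / 2) ^ j := by
  rw [coe_gridPt (gridIdx_le_two_pow j t), one_div, inv_pow]
  have h1 := gridIdx_le j t
  have h2 := lt_gridIdx_add_one j t
  have h3 : (0 : ℝ) < 2 ^ j := by positivity
  have h4 : (gridIdx j t : ℝ) / 2 ^ j - t = (gridIdx j t - 2 ^ j * t) * (2 ^ j : ℝ)⁻¹ := by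
    field_simp
  rw [h4, abs_mul, abs_of_pos (inv_pos.2 h3)]
  refine mul_le_of_le_one_left (by positivity) ?_
  rw [abs_le]
  constructor <;> linarith

theorem tendsto_gridPt (t : UnitTime) :
    Tendsto (fun j => gridPt j (gridIdx j t)) atTop (𝓝 t) := by
  rw [tendsto_subtype_rng, ← NNReal.tendsto_coe, tendsto_iff_dist_tendsto_zero]
  refine squeeze_zero (fun _ => dist_nonneg) (fun j => abs_gridPt_gridIdx_sub_le j t) ?_
  exact tendsto_pow_atTop_nhds_zero_of_lt_one (by norm_num) (by norm_num)

theorem gridIdx_succ (j : ℕ) (t : UnitTime) :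
    gridIdx (j + 1) t = 2 * gridIdx j t ∨ gridIdx (j + 1) t = 2 * gridIdx j t + 1 := by
  have h1 := gridIdx_le j t
  have h2 := lt_gridIdx_add_one j t
  have h3 := gridIdx_le (j + 1) t
  have h4 := lt_gridIdx_add_one (j + 1) t
  rw [pow_succ] at h3 h4
  have h5 : ((2 * gridIdx j t : ℕ) : ℝ) < (gridIdx (j + 1) t + 1 : ℕ) := by push_cast; linarith
  have h6 : ((gridIdx (j + 1) t : ℕ) : ℝ) < (2 * gridIdx j t + 2 : ℕ) := by push_cast; linarith
  have h7 := Nat.cast_lt.1 h5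
  have h8 := Nat.cast_lt.1 h6
  omega

theorem gridIdx_of_sub_le (j : ℕ) {s t : UnitTime} (hst : s ≤ t)
    (h : (t : ℝ) - s ≤ (1 / 2) ^ j) :
    gridIdx j t = gridIdx j s ∨ gridIdx j t = gridIdx j s + 1 := by
  have h1 := gridIdx_le j t
  have h2 := lt_gridIdx_add_one j s
  have h3 : gridIdx j s ≤ gridIdx j t := by
    refine Nat.floor_le_floor ?_
    have : (s : ℝ) ≤ t := by exact_mod_cast hst
    gcongr
  have h4 : (2 : ℝ) ^ j * t - 2 ^ j * s ≤ 1 := by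
    rw [← mul_sub]
    calc (2 : ℝ) ^ j * (t - s) ≤ 2 ^ j * (1 / 2) ^ j := by gcongr
      _ = 1 := by rw [← mul_pow]; norm_num
  have h5 : ((gridIdx j t : ℕ) : ℝ) < (gridIdx j s + 2 : ℕ) := by push_cast; linarith
  have h6 := Nat.cast_lt.1 h5
  omega

section Chaining

variable {E : Type*} [NormedAddCommGroup E] {N : E → ℝ≥0∞} {f y : UnitTime → E} {K ρ : ℝ≥0∞}

theorem increment_gridIdx_succ_le (hN0 : N 0 = 0)
    (hK : ∀ j, ∀ i < 2 ^ j, N (f (gridPt j (i + 1)) - f (gridPt j i)) ≤ K * ρ ^ j)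
    (j : ℕ) (t : UnitTime) :
    N (f (gridPt (j + 1) (gridIdx (j + 1) t)) - f (gridPt j (gridIdx j t))) ≤ K * ρ ^ (j + 1) := by
  rw [← gridPt_succ_two_mul j]
  have hle := gridIdx_le_two_pow (j + 1) t
  rcases gridIdx_succ j t with h | h <;> rw [h] at hle ⊢
  · simp [hN0]
  · exact hK (j + 1) _ (by omega)

theorem increment_gridIdx_le (hN0 : N 0 = 0) (hadd : ∀ x y, N (x + y) ≤ N x + N y)
    (hK : ∀ j, ∀ i < 2 ^ j, N (f (gridPt j (i + 1)) - f (gridPt j i)) ≤ K * ρ ^ j)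
    (j m : ℕ) (t : UnitTime) :
    N (f (gridPt (j + m) (gridIdx (j + m) t)) - f (gridPt j (gridIdx j t)))
      ≤ K * ρ ^ (j + 1) * (1 - ρ)⁻¹ := by
  have key : N (f (gridPt (j + m) (gridIdx (j + m) t)) - f (gridPt j (gridIdx j t)))
      ≤ K * ρ ^ (j + 1) * ∑ l ∈ Finset.range m, ρ ^ l := by
    induction m with
    | zero => simp [hN0]
    | succ m ih =>
      rw [Finset.sum_range_succ, mul_add, add_comm (K * ρ ^ (j + 1) * _),
        ← sub_add_sub_cancel _ (f (gridPt (j + m) (gridIdx (j + m) t))) _]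
      refine (hadd _ _).trans (add_le_add ?_ ih)
      refine (increment_gridIdx_succ_le hN0 hK (j + m) t).trans_eq ?_
      ring
  refine key.trans ?_
  gcongr
  rw [← ENNReal.tsum_geometric]
  exact ENNReal.sum_le_tsum _

/-- The dyadic values converge only in E, not for N, so the uniform bound passes to the limit
through closedness of the sublevel sets. Keeping f and its limit y distinct serves both continuous
paths and the construction of a modification. -/
theorem limit_sub_gridIdx_le (hN0 : N 0 = 0) (hadd : ∀ x y, N (x + y) ≤ N x + N y)
    (hcl : ∀ c, IsClosed {x | N x ≤ c})
    (hK : ∀ j, ∀ i < 2 ^ j, N (f (gridPt j (i + 1)) - f (gridPt j i)) ≤ K * ρ ^ j)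
    (hy : ∀ t, Tendsto (fun j => f (gridPt j (gridIdx j t))) atTop (𝓝 (y t)))
    (j : ℕ) (t : UnitTime) :
    N (y t - f (gridPt j (gridIdx j t))) ≤ K * ρ ^ (j + 1) * (1 - ρ)⁻¹ := by
  have h1 : Tendsto (fun m => f (gridPt (j + m) (gridIdx (j + m) t))
      - f (gridPt j (gridIdx j t))) atTop (𝓝 (y t - f (gridPt j (gridIdx j t)))) := by
    refine Tendsto.sub_const ?_ _
    have := (tendsto_add_atTop_iff_nat j).2 (hy t)
    simpa only [add_comm] using this
  exact (hcl _).mem_of_tendsto h1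
    (Eventually.of_forall fun m => increment_gridIdx_le hN0 hadd hK j m t)

/-- Two times at distance at most 2^(-j) have equal or adjacent level-j approximations: one grid
increment and two tails of the chain. -/
theorem limit_sub_limit_le (hN0 : N 0 = 0) (hadd : ∀ x y, N (x + y) ≤ N x + N y)
    (hneg : ∀ x, N (-x) = N x) (hcl : ∀ c, IsClosed {x | N x ≤ c}) (hρ : ρ ≤ 1)
    (hK : ∀ j, ∀ i < 2 ^ j, N (f (gridPt j (i + 1)) - f (gridPt j i)) ≤ K * ρ ^ j)
    (hy : ∀ t, Tendsto (fun j => f (gridPt j (gridIdx j t))) atTop (𝓝 (y t)))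
    (j : ℕ) {s t : UnitTime} (hst : s ≤ t) (h : (t : ℝ) - s ≤ (1 / 2) ^ j) :
    N (y t - y s) ≤ K * ρ ^ j * (1 + 2 * (1 - ρ)⁻¹) := by
  have h1 : ∀ t, N (y t - f (gridPt j (gridIdx j t))) ≤ K * ρ ^ j * (1 - ρ)⁻¹ := fun t => by
    refine (limit_sub_gridIdx_le hN0 hadd hcl hK hy j t).trans ?_
    gcongr K * ?_ * _
    exact pow_le_pow_right_of_le_one' hρ (Nat.le_succ j)
  have h2 : N (f (gridPt j (gridIdx j t)) - f (gridPt j (gridIdx j s))) ≤ K * ρ ^ j := by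
    have hle := gridIdx_le_two_pow j t
    rcases gridIdx_of_sub_le j hst h with h' | h' <;> rw [h'] at hle ⊢
    · simp [hN0]
    · exact hK j _ (by omega)
  have h3 : N (f (gridPt j (gridIdx j s)) - y s) ≤ K * ρ ^ j * (1 - ρ)⁻¹ := by
    rw [← hneg, neg_sub]
    exact h1 s
  calc N (y t - y s) = N ((y t - f (gridPt j (gridIdx j t)))
        + (f (gridPt j (gridIdx j t)) - f (gridPt j (gridIdx j s)))
        + (f (gridPt j (gridIdx j s)) - y s)) := by congr 1; abel
    _ ≤ K * ρ ^ j * (1 - ρ)⁻¹ + K * ρ ^ j + K * ρ ^ j * (1 - ρ)⁻¹ :=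
        (hadd _ _).trans (add_le_add ((hadd _ _).trans (add_le_add (h1 t) h2)) h3)
    _ = _ := by ring

/-- The dyadic scale ratio `2 ^ (-θ)` of Hölder continuity of order `θ`. -/
noncomputable def holderRatio (θ : ℝ) : ℝ≥0∞ := ENNReal.ofReal (2 ^ (-θ))

/-- The constant by which chaining over dyadic points increases a Hölder constant. -/
noncomputable def chainConst (θ : ℝ) : ℝ≥0∞ :=
  (1 + 2 * (1 - holderRatio θ)⁻¹) * ENNReal.ofReal (2 ^ θ)

theorem holderRatio_lt_one {θ : ℝ} (hθ : 0 < θ) : holderRatio θ < 1 := by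
  rw [holderRatio, ENNReal.ofReal_lt_one]
  exact Real.rpow_lt_one_of_one_lt_of_neg one_lt_two (by linarith)

theorem chainConst_lt_top {θ : ℝ} (hθ : 0 < θ) : chainConst θ < ∞ := by
  refine ENNReal.mul_lt_top ?_ ENNReal.ofReal_lt_top
  have : (1 - holderRatio θ)⁻¹ < ∞ := by
    rw [ENNReal.inv_lt_top]
    exact tsub_pos_of_lt (holderRatio_lt_one hθ)
  exact ENNReal.add_lt_top.2 ⟨ENNReal.one_lt_top, ENNReal.mul_lt_top ENNReal.ofNat_lt_top this⟩

theorem holderRatio_pow (θ : ℝ) (j : ℕ) :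
    holderRatio θ ^ j = ENNReal.ofReal (((1 / 2) ^ j) ^ θ) := by
  rw [holderRatio, ← ENNReal.ofReal_pow (by positivity), ← Real.rpow_natCast, ← Real.rpow_mul
    (by norm_num), ← Real.rpow_natCast, ← Real.rpow_mul (by norm_num), one_div,
    Real.inv_rpow (by norm_num), ← Real.rpow_neg (by norm_num)]
  congr 2
  ring

/-- Kolmogorov chaining: control of the increments between neighbouring dyadic points gives a
Hölder bound for the limit along dyadic approximations. -/
theorem limit_holder_le {θ : ℝ} (hθ : 0 < θ) (hN0 : N 0 = 0)
    (hadd : ∀ x y, N (x + y) ≤ N x + N y)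
    (hneg : ∀ x, N (-x) = N x) (hcl : ∀ c, IsClosed {x | N x ≤ c})
    (hK : ∀ j, ∀ i < 2 ^ j, N (f (gridPt j (i + 1)) - f (gridPt j i)) ≤ K * holderRatio θ ^ j)
    (hy : ∀ t, Tendsto (fun j => f (gridPt j (gridIdx j t))) atTop (𝓝 (y t)))
    (s t : UnitTime) :
    N (y t - y s) ≤ chainConst θ * K * ENNReal.ofReal (|(t : ℝ) - s| ^ θ) := by
  wlog hst : s < t generalizing s t
  · rcases (not_lt.1 hst).eq_or_lt with h | h
    · simp [h, hN0]
    · rw [← hneg, neg_sub, abs_sub_comm]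
      exact this t s h
  have hst' : (s : ℝ) < t := by exact_mod_cast hst
  have ht1 : (t : ℝ) ≤ 1 := by exact_mod_cast t.2.2
  have hs0 : (0 : ℝ) ≤ s := NNReal.coe_nonneg _
  -- Here 2^(-j-1) < t - s ≤ 2^(-j); the lower bound costs the factor 2^θ in `chainConst`.
  obtain ⟨j, hj1, hj2⟩ := exists_nat_pow_near_of_lt_one (sub_pos.2 hst') (by linarith)
    (by norm_num : (0 : ℝ) < 1 / 2) (by norm_num)
  refine (limit_sub_limit_le hN0 hadd hneg hcl (holderRatio_lt_one hθ).le hK hy j hst.le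
    hj2).trans ?_
  have h1 : holderRatio θ ^ j ≤ ENNReal.ofReal (2 ^ θ) * ENNReal.ofReal (|(t : ℝ) - s| ^ θ) := by
    rw [holderRatio_pow, ← ENNReal.ofReal_mul (by positivity), ← Real.mul_rpow (by norm_num)
      (abs_nonneg _), abs_of_pos (sub_pos.2 hst')]
    refine ENNReal.ofReal_le_ofReal (Real.rpow_le_rpow (by positivity) ?_ hθ.le)
    rw [pow_succ] at hj1
    linarith
  calc K * holderRatio θ ^ j * (1 + 2 * (1 - holderRatio θ)⁻¹)
      ≤ K * (ENNReal.ofReal (2 ^ θ) * ENNReal.ofReal (|(t : ℝ) - s| ^ θ))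
        * (1 + 2 * (1 - holderRatio θ)⁻¹) := by gcongr
    _ = _ := by rw [chainConst]; ring

end Chaining

end HeatNoise

/-! ### The `L^{2q}` norm as a functional on `L²`, and finite random sums of eigenfunctions. -/

namespace HeatNoise

instance isProbabilityMeasure_spaceMeasure : IsProbabilityMeasure spaceMeasure :=
  ⟨by simp [spaceMeasure]⟩

/-- The `L^{2q}(0,1)` norm on `L²(0,1)`, with value `∞` outside `L^{2q}(0,1)`. -/
noncomputable def spaceNorm (q : ℕ) (φ : L2) : ℝ≥0∞ := eLpNorm φ (2 * q : ℕ) spaceMeasure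

theorem spaceNorm_zero (q : ℕ) : spaceNorm q 0 = 0 := by
  rw [spaceNorm, eLpNorm_congr_ae (Lp.coeFn_zero _ _ _), eLpNorm_zero]

theorem spaceNorm_add_le {q : ℕ} (hq : 1 ≤ q) (φ ψ : L2) :
    spaceNorm q (φ + ψ) ≤ spaceNorm q φ + spaceNorm q ψ := by
  rw [spaceNorm, eLpNorm_congr_ae (Lp.coeFn_add _ _)]
  exact eLpNorm_add_le (Lp.aestronglyMeasurable _) (Lp.aestronglyMeasurable _)
    (by exact_mod_cast (by omega : 1 ≤ 2 * q))

theorem spaceNorm_neg (q : ℕ) (φ : L2) : spaceNorm q (-φ) = spaceNorm q φ := by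
  rw [spaceNorm, eLpNorm_congr_ae (Lp.coeFn_neg _), eLpNorm_neg, spaceNorm]

theorem spaceNorm_mono {p q : ℕ} (hpq : p ≤ q) (φ : L2) : spaceNorm p φ ≤ spaceNorm q φ :=
  eLpNorm_le_eLpNorm_of_exponent_le (by exact_mod_cast (by omega : 2 * p ≤ 2 * q))
    (Lp.aestronglyMeasurable _)

theorem enorm_eq_spaceNorm_one (φ : L2) : ‖φ‖ₑ = spaceNorm 1 φ := by
  rw [Lp.enorm_def, spaceNorm]
  norm_num

theorem enorm_le_spaceNorm {q : ℕ} (hq : 1 ≤ q) (φ : L2) : ‖φ‖ₑ ≤ spaceNorm q φ :=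
  (enorm_eq_spaceNorm_one φ).trans_le (spaceNorm_mono hq φ)

theorem spaceNorm_pow {q : ℕ} (hq : 1 ≤ q) (φ : L2) :
    spaceNorm q φ ^ (2 * q) = ∫⁻ x, ‖φ x‖ₑ ^ (2 * q) ∂spaceMeasure := by
  have := eLpNorm_nnreal_pow_eq_lintegral (f := φ) (μ := spaceMeasure) (p := (2 * q : ℕ))
    (by exact_mod_cast (by omega : 2 * q ≠ 0))
  simp only [NNReal.coe_natCast, ENNReal.rpow_natCast, ENNReal.coe_natCast] at this
  exact this

/-- An `L²`-convergent sequence has an almost everywhere convergent subsequence, to which Fatou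
applies. This is the closedness that chaining requires. -/
theorem isClosed_spaceNorm_le (q : ℕ) (c : ℝ≥0∞) : IsClosed {φ | spaceNorm q φ ≤ c} := by
  refine IsSeqClosed.isClosed fun u φ hu hφ => ?_
  obtain ⟨ns, -, hns⟩ := (tendstoInMeasure_of_tendsto_Lp hφ).exists_seq_tendsto_ae
  refine (Lp.eLpNorm_lim_le_liminf_eLpNorm (fun n => Lp.aestronglyMeasurable (u (ns n))) φ hns).trans
    ?_
  refine liminf_le_of_frequently_le' (Frequently.of_forall fun n => hu (ns n))

theorem lowerSemicontinuous_spaceNorm (q : ℕ) : LowerSemicontinuous (spaceNorm q) :=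
  lowerSemicontinuous_iff_isClosed_preimage.2 (isClosed_spaceNorm_le q)

theorem aemeasurable_spaceNorm {Ω : Type*} [MeasurableSpace Ω] {P : Measure Ω} {Y : Ω → L2}
    (hY : AEStronglyMeasurable Y P) (q : ℕ) : AEMeasurable (fun ω => spaceNorm q (Y ω)) P := by
  borelize L2
  exact (lowerSemicontinuous_spaceNorm q).measurable.comp_aemeasurable hY.aemeasurable

theorem inner_e_of_ne {k l : ℕ} (hkl : k ≠ l) : inner ℝ (e k) (e l) = 0 := by
  have hcos : ∀ m : ℤ, m ≠ 0 → ∫ x in (0 : ℝ)..1, Real.cos (m * Real.pi * x) = 0 := by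
    intro m hm
    have hc : (m : ℝ) * Real.pi ≠ 0 := mul_ne_zero (by exact_mod_cast hm) Real.pi_ne_zero
    rw [intervalIntegral.integral_comp_mul_left (fun x => Real.cos x) hc, integral_cos]
    simp [Real.sin_int_mul_pi]
  have h1 : inner ℝ (e k) (e l) = ∫ x in (0 : ℝ)..1, eigenfun k x * eigenfun l x := by
    rw [L2.inner_def, intervalIntegral.integral_of_le zero_le_one, integral_Ioc_eq_integral_Ioo]
    refine integral_congr_ae ?_
    filter_upwards [(memLp_eigenfun k).coeFn_toLp, (memLp_eigenfun l).coeFn_toLp] with x hk hl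
    simp only [e, hk, hl, RCLike.inner_apply, conj_trivial]
    ring
  have h2 : ∀ x, eigenfun k x * eigenfun l x
      = Real.cos (((k : ℤ) - l : ℤ) * Real.pi * x) - Real.cos (((k : ℤ) + l + 2 : ℤ) * Real.pi * x) := by
    intro x
    have e1 : (((k : ℤ) - l : ℤ) : ℝ) * Real.pi * x
        = (k + 1) * Real.pi * x - (l + 1) * Real.pi * x := by push_cast; ring
    have e2 : (((k : ℤ) + l + 2 : ℤ) : ℝ) * Real.pi * x
        = (k + 1) * Real.pi * x + (l + 1) * Real.pi * x := by push_cast; ring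
    have e3 : √2 * √2 = 2 := Real.mul_self_sqrt zero_le_two
    rw [e1, e2, Real.cos_sub, Real.cos_add, eigenfun, eigenfun]
    linear_combination (Real.sin ((k + 1) * Real.pi * x) * Real.sin ((l + 1) * Real.pi * x)) * e3
  rw [h1]
  simp_rw [h2]
  rw [intervalIntegral.integral_sub (Continuous.intervalIntegrable (by fun_prop) _ _)
    (Continuous.intervalIntegrable (by fun_prop) _ _), hcos _ (by omega), hcos _ (by omega),
    sub_zero]

/-- Orthogonality suffices: the unevaluated factor ⟨e k, e k⟩ will appear on both sides of the
relation defining the fractional Laplacian. -/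
theorem inner_e_sum_range (k N : ℕ) (c : ℕ → ℝ) : inner ℝ (e k) (∑ j ∈ Finset.range N, c j • e j)
    = (if k < N then c k else 0) * inner ℝ (e k) (e k) := by
  rw [inner_sum]
  simp_rw [inner_smul_right]
  have : ∀ j ∈ Finset.range N, c j * inner ℝ (e k) (e j)
      = if k = j then c k * inner ℝ (e k) (e k) else 0 := by
    intro j _
    split_ifs with h
    · rw [h]
    · rw [inner_e_of_ne h, mul_zero]
  rw [Finset.sum_congr rfl this, Finset.sum_ite_eq]
  simp

theorem coeFn_sum_smul_e (s : Finset ℕ) (c : ℕ → ℝ) :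
    ⇑(∑ k ∈ s, c k • e k) =ᵐ[spaceMeasure] fun x => ∑ k ∈ s, c k * eigenfun k x := by
  have h : ∀ᵐ x ∂spaceMeasure, ∀ k, (c k • e k : L2) x = c k * eigenfun k x := by
    refine ae_all_iff.2 fun k => ?_
    filter_upwards [Lp.coeFn_smul (c k) (e k), (memLp_eigenfun k).coeFn_toLp] with x h1 h2
    rw [h1, Pi.smul_apply, e, h2, smul_eq_mul]
  filter_upwards [Lp.coeFn_finsetSum s fun k => (c k • e k : L2), h] with x h1 h2
  rw [h1, Finset.sum_apply]
  exact Finset.sum_congr rfl fun k _ => h2 k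

theorem eigenfun_sq_le (k : ℕ) (x : ℝ) : eigenfun k x ^ 2 ≤ 2 := by
  rw [eigenfun, mul_pow, Real.sq_sqrt zero_le_two]
  have := Real.sin_sq_le_one ((k + 1) * Real.pi * x)
  linarith

@[fun_prop]
theorem continuous_eigenfun (k : ℕ) : Continuous (eigenfun k) := by
  unfold eigenfun
  fun_prop

theorem lintegral_enorm_pow_eq {Ω : Type*} [MeasurableSpace Ω] {P : Measure Ω}
    [IsFiniteMeasure P] {f : Ω → ℝ} {q : ℕ} (hf : MemLp f (2 * q : ℕ) P) :
    ∫⁻ ω, ‖f ω‖ₑ ^ (2 * q) ∂P = ENNReal.ofReal (∫ ω, f ω ^ (2 * q) ∂P) := by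
  rw [ofReal_integral_eq_lintegral_ofReal (integrable_pow_of_memLp hf)
    (Eventually.of_forall fun ω => (even_two_mul q).pow_nonneg _)]
  refine lintegral_congr fun ω => ?_
  rw [Real.enorm_eq_ofReal_abs, ← ENNReal.ofReal_pow (abs_nonneg _), (even_two_mul q).pow_abs]

/-- Moment bound for random finite combinations of the eigenfunctions. -/
theorem lintegral_spaceNorm_sum_pow_le {Ω : Type*} [MeasurableSpace Ω] {P : Measure Ω}
    [IsProbabilityMeasure P] {ξ : ℕ → Ω → ℝ} (hind : iIndepFun ξ P)
    (hL : ∀ k (n : ℕ), MemLp (ξ k) n P) (h0 : ∀ k, ∫ ω, ξ k ω ∂P = 0)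
    {C : ℕ → ℝ} (hC : ∀ j, 0 ≤ C j) {h : ℝ} (hh : 0 ≤ h)
    (hm : ∀ k j, 1 ≤ j → ∫ ω, ξ k ω ^ (2 * j) ∂P ≤ C j * h ^ j)
    (c : ℕ → ℝ) (s : Finset ℕ) {q : ℕ} (hq : 1 ≤ q) :
    ∫⁻ ω, spaceNorm q (∑ k ∈ s, (c k * ξ k ω) • e k) ^ (2 * q) ∂P
      ≤ ENNReal.ofReal (momentConst C q * (h * (2 * ∑ k ∈ s, c k ^ 2)) ^ q) := by
  have hξ : ∀ k, AEMeasurable (ξ k) P := fun k => (hL k 0).1.aemeasurable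
  have hmeas : AEMeasurable (Function.uncurry fun ω x =>
      ‖∑ k ∈ s, c k * ξ k ω * eigenfun k x‖ₑ ^ (2 * q)) (P.prod spaceMeasure) := by
    refine AEMeasurable.pow_const (AEMeasurable.enorm ?_) _
    refine Finset.aemeasurable_fun_sum s fun k _ => ?_
    refine AEMeasurable.mul (((hξ k).comp_fst).const_mul _) ?_
    exact ((continuous_eigenfun k).measurable.comp measurable_snd).aemeasurable
  calc ∫⁻ ω, spaceNorm q (∑ k ∈ s, (c k * ξ k ω) • e k) ^ (2 * q) ∂P
      = ∫⁻ ω, ∫⁻ x, ‖∑ k ∈ s, c k * ξ k ω * eigenfun k x‖ₑ ^ (2 * q) ∂spaceMeasure ∂P := by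
        refine lintegral_congr fun ω => ?_
        rw [spaceNorm_pow hq]
        refine lintegral_congr_ae ?_
        filter_upwards [coeFn_sum_smul_e s fun k => c k * ξ k ω] with x hx
        rw [hx]
    -- After Tonelli, x is fixed and the scalar moment bound applies with coefficients c_k e_k(x).
    _ = ∫⁻ x, ∫⁻ ω, ‖∑ k ∈ s, c k * ξ k ω * eigenfun k x‖ₑ ^ (2 * q) ∂P ∂spaceMeasure :=
        lintegral_lintegral_swap hmeas
    _ ≤ ∫⁻ x, ENNReal.ofReal (momentConst C q * (h * (2 * ∑ k ∈ s, c k ^ 2)) ^ q)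
          ∂spaceMeasure := by
        refine lintegral_mono fun x => ?_
        have e1 : ∀ ω, ∑ k ∈ s, c k * ξ k ω * eigenfun k x
            = ∑ k ∈ s, (c k * eigenfun k x) * ξ k ω :=
          fun ω => Finset.sum_congr rfl fun k _ => by ring
        simp_rw [e1]
        rw [lintegral_enorm_pow_eq (memLp_finsetSum _ fun k _ => (hL k _).const_mul _)]
        refine ENNReal.ofReal_le_ofReal ?_
        refine (integral_even_pow_sum_le hind hL h0 hC hh hm
          (fun k => c k * eigenfun k x) s q).trans ?_
        have := momentConst_nonneg hC q
        gcongr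
        rw [Finset.mul_sum]
        refine Finset.sum_le_sum fun k _ => ?_
        rw [mul_pow, mul_comm]
        exact mul_le_mul_of_nonneg_right (eigenfun_sq_le k x) (sq_nonneg _)
    _ = _ := by simp

end HeatNoise

/-! ### Random series in `L²(Ω; L²(0,1))` and their fractional Laplacians. -/

namespace HeatNoise

variable {Ω : Type*} [MeasurableSpace Ω] {P : Measure Ω}

theorem lintegral_spaceNorm_pow_le_of_tendsto {Y : Ω → L2} {u : ℕ → Ω → L2} {q m : ℕ}
    {c : ℝ≥0∞} (hu : ∀ n, AEStronglyMeasurable (u n) P)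
    (hlim : ∀ᵐ ω ∂P, Tendsto (fun n => u n ω) atTop (𝓝 (Y ω)))
    (hc : ∀ n, ∫⁻ ω, spaceNorm q (u n ω) ^ m ∂P ≤ c) :
    ∫⁻ ω, spaceNorm q (Y ω) ^ m ∂P ≤ c := by
  have hlsc : LowerSemicontinuous fun φ => spaceNorm q φ ^ m :=
    (ENNReal.continuous_pow m).comp_lowerSemicontinuous (lowerSemicontinuous_spaceNorm q)
      (fun a b hab => by simp only; gcongr)
  calc ∫⁻ ω, spaceNorm q (Y ω) ^ m ∂P
      ≤ ∫⁻ ω, liminf (fun n => spaceNorm q (u n ω) ^ m) atTop ∂P := by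
        refine lintegral_mono_ae ?_
        filter_upwards [hlim] with ω hω
        exact (hlsc.le_liminf (Y ω)).trans (liminf_le_liminf_of_le hω)
    _ ≤ liminf (fun n => ∫⁻ ω, spaceNorm q (u n ω) ^ m ∂P) atTop :=
        lintegral_liminf_le' fun n => (aemeasurable_spaceNorm (hu n) q).pow_const _
    _ ≤ c := liminf_le_of_frequently_le' (Frequently.of_forall hc)

theorem eLpNorm_two_sq (f : Ω → L2) : eLpNorm f 2 P ^ 2 = ∫⁻ ω, ‖f ω‖ₑ ^ 2 ∂P := by
  have := eLpNorm_nnreal_pow_eq_lintegral (f := f) (μ := P) (p := 2) two_ne_zero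
  simpa using this

/-- The partial sums of the random series `∑ₖ √(λₖ) ξₖ eₖ`. -/
noncomputable def seriesPartialSum (lam : ℕ → ℝ) (ξ : ℕ → Ω → ℝ) (N : ℕ) (ω : Ω) : L2 :=
  ∑ k ∈ Finset.range N, (√(lam k) * ξ k ω) • e k

/-- `Y` is the sum of the random series `∑ₖ √(λₖ) ξₖ eₖ` in `L²(Ω; L²(0,1))`. -/
def IsSeriesSum (P : Measure Ω) (lam : ℕ → ℝ) (ξ : ℕ → Ω → ℝ) (Y : Ω → L2) : Prop :=
  AEStronglyMeasurable Y P ∧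
    Tendsto (fun N : ℕ => ∫⁻ ω, ‖Y ω - seriesPartialSum lam ξ N ω‖ₑ ^ 2 ∂P) atTop (𝓝 0)

theorem isNoise_iff {lam : ℕ → ℝ} {X : ℕ → UnitTime → Ω → ℝ} {V : UnitTime → Ω → L2} :
    IsNoise P lam X V ↔ ∀ t, IsSeriesSum P lam (fun k => X k t) (V t) := Iff.rfl

theorem aestronglyMeasurable_seriesPartialSum {lam : ℕ → ℝ} {ξ : ℕ → Ω → ℝ}
    (hξ : ∀ k, AEMeasurable (ξ k) P) (N : ℕ) :
    AEStronglyMeasurable (seriesPartialSum lam ξ N) P := by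
  unfold seriesPartialSum
  refine Finset.aestronglyMeasurable_fun_sum _ fun k _ => ?_
  exact ((hξ k).const_mul _).aestronglyMeasurable.smul_const _

theorem IsSeriesSum.congr {lam : ℕ → ℝ} {ξ : ℕ → Ω → ℝ} {Y Y' : Ω → L2}
    (h : IsSeriesSum P lam ξ Y) (hY : Y =ᵐ[P] Y') : IsSeriesSum P lam ξ Y' := by
  refine ⟨h.1.congr hY, h.2.congr fun N => lintegral_congr_ae ?_⟩
  filter_upwards [hY] with ω hω
  rw [hω]

theorem IsSeriesSum.tendstoInMeasure {lam : ℕ → ℝ} {ξ : ℕ → Ω → ℝ} {Y : Ω → L2}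
    (hξ : ∀ k, AEMeasurable (ξ k) P) (h : IsSeriesSum P lam ξ Y) :
    TendstoInMeasure P (seriesPartialSum lam ξ) atTop Y := by
  refine tendstoInMeasure_of_tendsto_eLpNorm two_ne_zero
    (aestronglyMeasurable_seriesPartialSum hξ) h.1 ?_
  have h1 := h.2.ennrpow_const (1 / 2)
  rw [ENNReal.zero_rpow_of_pos (by norm_num)] at h1
  refine h1.congr fun N => ?_
  simp_rw [← edist_eq_enorm_sub, edist_comm (Y _), edist_eq_enorm_sub]
  rw [← eLpNorm_two_sq, ← ENNReal.rpow_natCast, ← ENNReal.rpow_mul]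
  norm_num
  rfl

theorem IsSeriesSum.ae_eq {lam : ℕ → ℝ} {ξ : ℕ → Ω → ℝ} {Y Y' : Ω → L2}
    (hξ : ∀ k, AEMeasurable (ξ k) P) (h : IsSeriesSum P lam ξ Y)
    (h' : IsSeriesSum P lam ξ Y') : Y =ᵐ[P] Y' :=
  tendstoInMeasure_ae_unique (h.tendstoInMeasure hξ) (h'.tendstoInMeasure hξ)

theorem enorm_sub_sq_le (a b : L2) : ‖a - b‖ₑ ^ 2 ≤ 2 * (‖a‖ₑ ^ 2 + ‖b‖ₑ ^ 2) := by
  have h1 : ‖a - b‖ ^ 2 ≤ 2 * (‖a‖ ^ 2 + ‖b‖ ^ 2) :=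
    (pow_le_pow_left₀ (norm_nonneg _) (norm_sub_le a b) 2).trans add_sq_le
  calc ‖a - b‖ₑ ^ 2 = ENNReal.ofReal (‖a - b‖ ^ 2) := by
        rw [← ofReal_norm, ENNReal.ofReal_pow (norm_nonneg _)]
    _ ≤ ENNReal.ofReal (2 * (‖a‖ ^ 2 + ‖b‖ ^ 2)) := ENNReal.ofReal_le_ofReal h1
    _ = 2 * (‖a‖ₑ ^ 2 + ‖b‖ₑ ^ 2) := by
        rw [ENNReal.ofReal_mul zero_le_two, ENNReal.ofReal_add (by positivity) (by positivity),
          ENNReal.ofReal_pow (norm_nonneg _), ENNReal.ofReal_pow (norm_nonneg _), ofReal_norm,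
          ofReal_norm, ENNReal.ofReal_ofNat]

theorem IsSeriesSum.sub {lam : ℕ → ℝ} {ξ ξ' : ℕ → Ω → ℝ} {Y Y' : Ω → L2}
    (hξ : ∀ k, AEMeasurable (ξ k) P)
    (h : IsSeriesSum P lam ξ Y) (h' : IsSeriesSum P lam ξ' Y') :
    IsSeriesSum P lam (fun k ω => ξ k ω - ξ' k ω) (fun ω => Y ω - Y' ω) := by
  refine ⟨h.1.sub h'.1, ?_⟩
  have h0 := ENNReal.Tendsto.const_mul (a := 2) (h.2.add h'.2) (Or.inr ENNReal.ofNat_ne_top)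
  rw [add_zero, mul_zero] at h0
  refine tendsto_of_tendsto_of_tendsto_of_le_of_le tendsto_const_nhds h0 (fun _ => zero_le)
    fun N => ?_
  simp only
  have hm : AEMeasurable (fun ω => ‖Y ω - seriesPartialSum lam ξ N ω‖ₑ ^ 2) P :=
    (h.1.sub (aestronglyMeasurable_seriesPartialSum hξ N)).enorm.pow_const 2
  rw [← lintegral_add_left' hm, ← lintegral_const_mul' _ _ ENNReal.ofNat_ne_top]
  refine lintegral_mono fun ω => ?_
  have e1 : Y ω - Y' ω - seriesPartialSum lam (fun k ω => ξ k ω - ξ' k ω) N ω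
      = (Y ω - seriesPartialSum lam ξ N ω) - (Y' ω - seriesPartialSum lam ξ' N ω) := by
    simp only [seriesPartialSum, mul_sub, sub_smul, Finset.sum_sub_distrib]
    abel
  rw [e1]
  exact enorm_sub_sq_le _ _

/-- The variables `ξ k` are independent, centered, and have even moments of all orders controlled
by `C` at the scale `h` of the variance. -/
structure IsIndepCentered (P : Measure Ω) (ξ : ℕ → Ω → ℝ) (C : ℕ → ℝ) (h : ℝ) : Prop where
  indep : iIndepFun ξ P
  memLp : ∀ k (n : ℕ), MemLp (ξ k) n P
  integral_eq_zero : ∀ k, ∫ ω, ξ k ω ∂P = 0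
  scale_nonneg : 0 ≤ h
  moment_le : ∀ k j, 1 ≤ j → ∫ ω, ξ k ω ^ (2 * j) ∂P ≤ C j * h ^ j

theorem IsIndepCentered.aemeasurable {ξ : ℕ → Ω → ℝ} {C : ℕ → ℝ} {h : ℝ}
    (hξ : IsIndepCentered P ξ C h) (k : ℕ) : AEMeasurable (ξ k) P :=
  (hξ.memLp k 0).1.aemeasurable

section Series

variable [IsProbabilityMeasure P] {lam : ℕ → ℝ} {ξ : ℕ → Ω → ℝ} {C : ℕ → ℝ} {h : ℝ}

theorem IsIndepCentered.lintegral_spaceNorm_le (hξ : IsIndepCentered P ξ C h)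
    (hC : ∀ j, 0 ≤ C j) (hlam : ∀ k, 0 ≤ lam k) (s : Finset ℕ) {q : ℕ} (hq : 1 ≤ q) :
    ∫⁻ ω, spaceNorm q (∑ k ∈ s, (√(lam k) * ξ k ω) • e k) ^ (2 * q) ∂P
      ≤ ENNReal.ofReal (momentConst C q * (h * (2 * ∑ k ∈ s, lam k)) ^ q) := by
  have := lintegral_spaceNorm_sum_pow_le hξ.indep hξ.memLp hξ.integral_eq_zero hC
    hξ.scale_nonneg hξ.moment_le (fun k => √(lam k)) s hq
  simpa only [Real.sq_sqrt (hlam _)] using this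

theorem IsSeriesSum.lintegral_spaceNorm_le {Y : Ω → L2} (hξ : IsIndepCentered P ξ C h)
    (hC : ∀ j, 0 ≤ C j) (hlam : ∀ k, 0 ≤ lam k) (hsum : Summable lam)
    (hY : IsSeriesSum P lam ξ Y) {q : ℕ} (hq : 1 ≤ q) :
    ∫⁻ ω, spaceNorm q (Y ω) ^ (2 * q) ∂P
      ≤ ENNReal.ofReal (momentConst C q * (h * (2 * ∑' k, lam k)) ^ q) := by
  obtain ⟨ns, -, hns⟩ := (hY.tendstoInMeasure hξ.aemeasurable).exists_seq_tendsto_ae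
  refine lintegral_spaceNorm_pow_le_of_tendsto
    (fun n => aestronglyMeasurable_seriesPartialSum hξ.aemeasurable (ns n)) hns fun n => ?_
  refine (hξ.lintegral_spaceNorm_le hC hlam _ hq).trans (ENNReal.ofReal_le_ofReal ?_)
  have := momentConst_nonneg hC q
  have := hξ.scale_nonneg
  have := Finset.sum_nonneg fun k (_ : k ∈ Finset.range (ns n)) => hlam k
  gcongr
  exact hsum.sum_le_tsum _ fun k _ => hlam k

/-- The moment bound with q = 1 controls the squared norm of every finite block by a multiple of its
total weight, so summability of the weights gives the Cauchy criterion in `L²(Ω; L²(0,1))`. -/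
theorem IsIndepCentered.exists_isSeriesSum (hξ : IsIndepCentered P ξ C h)
    (hC : ∀ j, 0 ≤ C j) (hlam : ∀ k, 0 ≤ lam k) (hsum : Summable lam) :
    ∃ Y, IsSeriesSum P lam ξ Y := by
  have hF : ∀ k, MemLp (fun ω => (√(lam k) * ξ k ω) • e k) 2 P := fun k => by
    have : MemLp (fun ω => √(lam k) * ξ k ω) 2 P := (hξ.memLp k 2).const_mul _
    refine this.of_le_mul (c := ‖e k‖) (this.1.smul_const _) (Eventually.of_forall fun ω => ?_)
    rw [norm_smul, mul_comm]
  set F : ℕ → Lp L2 2 P := fun k => (hF k).toLp _ with hFdef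
  have hFsum : ∀ s : Finset ℕ, ⇑(∑ k ∈ s, F k) =ᵐ[P] fun ω => ∑ k ∈ s, (√(lam k) * ξ k ω) • e k := by
    intro s
    have h1 : ∀ᵐ ω ∂P, ∀ k, F k ω = (√(lam k) * ξ k ω) • e k :=
      ae_all_iff.2 fun k => (hF k).coeFn_toLp
    filter_upwards [Lp.coeFn_finsetSum s F, h1] with ω h2 h3
    rw [h2, Finset.sum_apply]
    exact Finset.sum_congr rfl fun k _ => h3 k
  set B := momentConst C 1 * h * 2 with hB
  have hB0 : 0 ≤ B := by
    have := momentConst_nonneg hC 1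
    have := hξ.scale_nonneg
    positivity
  have hnorm : ∀ s : Finset ℕ, ‖∑ k ∈ s, F k‖ ^ 2 ≤ B * ∑ k ∈ s, lam k := by
    intro s
    have h1 := hξ.lintegral_spaceNorm_le hC hlam s le_rfl
    simp_rw [← enorm_eq_spaceNorm_one, mul_one, pow_one] at h1
    rw [← eLpNorm_two_sq, ← eLpNorm_congr_ae (hFsum s), ← Lp.enorm_def, ← ofReal_norm,
      ← ENNReal.ofReal_pow (norm_nonneg _), ENNReal.ofReal_le_ofReal_iff] at h1
    · linarith
    · have := Finset.sum_nonneg fun k (_ : k ∈ s) => hlam k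
      have := momentConst_nonneg hC 1
      have := hξ.scale_nonneg
      positivity
  have hsummable : Summable F := by
    rw [summable_iff_vanishing_norm] at hsum ⊢
    intro ε hε
    obtain ⟨s, hs⟩ := hsum (ε ^ 2 / (B + 1)) (by positivity)
    refine ⟨s, fun t ht => ?_⟩
    have h1 := hs t ht
    have h0 := Finset.sum_nonneg fun k (_ : k ∈ t) => hlam k
    rw [Real.norm_of_nonneg h0, lt_div_iff₀ (by positivity)] at h1
    refine lt_of_pow_lt_pow_left₀ 2 hε.le ((hnorm t).trans_lt ?_)
    linarith
  refine ⟨⇑(∑' k, F k), Lp.aestronglyMeasurable _, ?_⟩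
  have h1 := hsummable.hasSum.tendsto_sum_nat
  have h2 : Tendsto (fun N => ‖(∑' k, F k) - ∑ k ∈ Finset.range N, F k‖ₑ ^ 2) atTop (𝓝 0) := by
    have h3 : Tendsto (fun N => (∑' k, F k) - ∑ k ∈ Finset.range N, F k) atTop (𝓝 0) := by
      have := (tendsto_const_nhds (x := ∑' k, F k)).sub h1
      rwa [sub_self] at this
    have h4 := ENNReal.Tendsto.pow (n := 2) h3.enorm
    simpa using h4
  refine h2.congr fun N => ?_
  rw [Lp.enorm_def, eLpNorm_two_sq]
  refine lintegral_congr_ae ?_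
  filter_upwards [Lp.coeFn_sub (∑' k, F k) (∑ k ∈ Finset.range N, F k),
    hFsum (Finset.range N)] with ω h3 h4
  rw [h3, Pi.sub_apply, h4]
  rfl

end Series

/-- The graph of `(-Δ)^η` is closed, since it is defined by continuous conditions mode by mode. -/
theorem isFracLaplacian_of_tendsto {η : ℝ} {φ ψ : L2} {u v : ℕ → L2}
    (hu : Tendsto u atTop (𝓝 φ)) (hv : Tendsto v atTop (𝓝 ψ))
    (huv : ∀ n, IsFracLaplacian η (u n) (v n)) : IsFracLaplacian η φ ψ := by
  intro k
  have h1 : Tendsto (fun n => inner ℝ (e k) (v n)) atTop (𝓝 (inner ℝ (e k) ψ)) :=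
    ((continuous_const.inner continuous_id).tendsto ψ).comp hv
  have h2 : Tendsto (fun n => eigenvalue k ^ η * inner ℝ (e k) (u n)) atTop
      (𝓝 (eigenvalue k ^ η * inner ℝ (e k) φ)) :=
    (((continuous_const.inner continuous_id).tendsto φ).comp hu).const_mul _
  exact tendsto_nhds_unique h1 (h2.congr fun n => (huv n k).symm)

theorem IsFracLaplacian.sub {η : ℝ} {φ ψ φ' ψ' : L2} (h : IsFracLaplacian η φ ψ)
    (h' : IsFracLaplacian η φ' ψ') : IsFracLaplacian η (φ - φ') (ψ - ψ') := fun k => by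
  rw [inner_sub_right, inner_sub_right, h k, h' k, mul_sub]

theorem isFracLaplacian_zero (η : ℝ) : IsFracLaplacian η 0 0 := fun k => by simp

/-- The weights of the image under `(-Δ)^η` of the series with weights `lam`. -/
noncomputable def fracWeight (η : ℝ) (lam : ℕ → ℝ) (k : ℕ) : ℝ := lam k * eigenvalue k ^ (2 * η)

theorem eigenvalue_pos (k : ℕ) : 0 < eigenvalue k := by
  have := Real.pi_pos
  unfold eigenvalue
  positivity

theorem fracWeight_nonneg {lam : ℕ → ℝ} (hlam : ∀ k, 0 ≤ lam k) (η : ℝ) (k : ℕ) :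
    0 ≤ fracWeight η lam k :=
  mul_nonneg (hlam k) (Real.rpow_nonneg (eigenvalue_pos k).le _)

theorem sqrt_fracWeight {lam : ℕ → ℝ} (hlam : ∀ k, 0 ≤ lam k) (η : ℝ) (k : ℕ) :
    √(fracWeight η lam k) = eigenvalue k ^ η * √(lam k) := by
  rw [fracWeight, Real.sqrt_mul (hlam k), mul_comm 2 η, Real.rpow_mul (eigenvalue_pos k).le,
    Real.rpow_two, Real.sqrt_sq (Real.rpow_nonneg (eigenvalue_pos k).le _), mul_comm]

theorem summable_fracWeight {lam : ℕ → ℝ} {η : ℝ}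
    (hsum : Summable fun k : ℕ => lam k * ((k : ℝ) + 1) ^ (4 * η)) :
    Summable (fracWeight η lam) := by
  refine (hsum.mul_right (Real.pi ^ (4 * η))).congr fun k => ?_
  have hk : (0 : ℝ) ≤ (k : ℝ) + 1 := by positivity
  rw [fracWeight, eigenvalue, ← Real.rpow_natCast, ← Real.rpow_mul (by positivity),
    Real.mul_rpow hk Real.pi_pos.le, mul_assoc]
  push_cast
  ring_nf

theorem summable_of_summable_mul_rpow {lam : ℕ → ℝ} {η : ℝ} (hlam : ∀ k, 0 ≤ lam k) (hη : 0 < η)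
    (hsum : Summable fun k : ℕ => lam k * ((k : ℝ) + 1) ^ (4 * η)) : Summable lam := by
  refine Summable.of_nonneg_of_le hlam (fun k => ?_) hsum
  refine le_mul_of_one_le_right (hlam k) (Real.one_le_rpow ?_ (by positivity))
  have : (0 : ℝ) ≤ k := Nat.cast_nonneg k
  linarith

theorem isFracLaplacian_seriesPartialSum {S : Type*} {lam : ℕ → ℝ} (hlam : ∀ k, 0 ≤ lam k)
    (η : ℝ) (ξ : ℕ → S → ℝ) (N : ℕ) (ω : S) :
    IsFracLaplacian η (seriesPartialSum lam ξ N ω) (seriesPartialSum (fracWeight η lam) ξ N ω) := by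
  intro k
  rw [seriesPartialSum, seriesPartialSum, inner_e_sum_range, inner_e_sum_range,
    sqrt_fracWeight hlam]
  split_ifs <;> ring

theorem IsSeriesSum.ae_isFracLaplacian {lam : ℕ → ℝ} (hlam : ∀ k, 0 ≤ lam k) {η : ℝ}
    {ξ : ℕ → Ω → ℝ} {Y Z : Ω → L2} (hξ : ∀ k, AEMeasurable (ξ k) P)
    (hY : IsSeriesSum P lam ξ Y) (hZ : IsSeriesSum P (fracWeight η lam) ξ Z) :
    ∀ᵐ ω ∂P, IsFracLaplacian η (Y ω) (Z ω) := by
  obtain ⟨ns, hmono, hns⟩ := (hY.tendstoInMeasure hξ).exists_seq_tendsto_ae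
  -- Extracting from the first subsequence makes both series converge along the same indices.
  obtain ⟨ms, hms', hms⟩ := ((hZ.tendstoInMeasure hξ).comp hmono.tendsto_atTop).exists_seq_tendsto_ae
  filter_upwards [hns, hms] with ω h1 h2
  exact isFracLaplacian_of_tendsto (h1.comp hms'.tendsto_atTop) h2
    fun n => isFracLaplacian_seriesPartialSum hlam η ξ _ ω

theorem sobolevNorm_le {η : ℝ} {φ ψ : L2} (h : IsFracLaplacian η φ ψ) (q : ℕ) :
    sobolevNorm η (2 * q : ℕ) φ ≤ spaceNorm q ψ :=
  iInf₂_le ψ h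

end HeatNoise

/-! ### The Kolmogorov criterion. -/

namespace HeatNoise

/-- The `2q`-th power of `holderConst`. -/
noncomputable def holderConstPow (q : ℕ) (θ : ℝ) (z : UnitTime → L2) : ℝ≥0∞ :=
  ∑' j : ℕ, (holderRatio θ ^ j)⁻¹ ^ (2 * q) * ∑ i ∈ Finset.range (2 ^ j),
    spaceNorm q (z (gridPt j (i + 1)) - z (gridPt j i)) ^ (2 * q)

/-- A bound for the `θ`-Hölder constant of the restriction of a path to neighbouring dyadic points,
with respect to the `L^{2q}(0,1)` norm. -/
noncomputable def holderConst (q : ℕ) (θ : ℝ) (z : UnitTime → L2) : ℝ≥0∞ :=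
  holderConstPow q θ z ^ ((2 * q : ℕ) : ℝ)⁻¹

theorem holderConst_pow {q : ℕ} (hq : 1 ≤ q) (θ : ℝ) (z : UnitTime → L2) :
    holderConst q θ z ^ (2 * q) = holderConstPow q θ z :=
  ENNReal.rpow_inv_natCast_pow (by omega) _

theorem holderRatio_ne_zero (θ : ℝ) : holderRatio θ ≠ 0 := by
  rw [holderRatio, ENNReal.ofReal_ne_zero_iff]
  positivity

theorem holderRatio_ne_top (θ : ℝ) : holderRatio θ ≠ ∞ := ENNReal.ofReal_ne_top

theorem increment_le_holderConst {q : ℕ} (hq : 1 ≤ q) (θ : ℝ) (z : UnitTime → L2)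
    (j i : ℕ) (hi : i < 2 ^ j) :
    spaceNorm q (z (gridPt j (i + 1)) - z (gridPt j i))
      ≤ holderConst q θ z * holderRatio θ ^ j := by
  set n := spaceNorm q (z (gridPt j (i + 1)) - z (gridPt j i)) with hn
  have h0 : holderRatio θ ^ j ≠ 0 := pow_ne_zero _ (holderRatio_ne_zero θ)
  have h1 : holderRatio θ ^ j ≠ ∞ := ENNReal.pow_ne_top (holderRatio_ne_top θ)
  have h2 : ((holderRatio θ ^ j)⁻¹ * n) ^ (2 * q) ≤ holderConst q θ z ^ (2 * q) := by
    rw [holderConst_pow hq, mul_pow]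
    refine le_trans ?_ (ENNReal.le_tsum j)
    gcongr
    exact Finset.single_le_sum (f := fun i =>
      spaceNorm q (z (gridPt j (i + 1)) - z (gridPt j i)) ^ (2 * q)) (fun _ _ => zero_le)
      (Finset.mem_range.2 hi)
  have h3 : (holderRatio θ ^ j)⁻¹ * n ≤ holderConst q θ z :=
    (ENNReal.pow_le_pow_left_iff (by omega)).1 h2
  rw [mul_comm] at h3
  exact (ENNReal.div_le_iff h0 h1).1 h3

/-- The constant in the Kolmogorov criterion. -/
noncomputable def kolmogorovConst (q : ℕ) (θ b : ℝ) : ℝ≥0∞ :=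
  (1 - (holderRatio θ)⁻¹ ^ (2 * q) * 2 * holderRatio b)⁻¹

/-- Level j contributes 2^j increments of moment 2^(-bj), weighted by 2^(2qθj): a geometric series
of ratio 2^(1+2qθ-b). -/
theorem kolmogorovConst_lt_top {q : ℕ} {θ b : ℝ} (hb : 1 + 2 * q * θ < b) :
    kolmogorovConst q θ b < ∞ := by
  rw [kolmogorovConst, ENNReal.inv_lt_top]
  refine tsub_pos_of_lt ?_
  have h1 : (holderRatio θ)⁻¹ ^ (2 * q) * 2 * holderRatio b
      = ENNReal.ofReal (2 ^ (1 + 2 * q * θ - b)) := by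
    rw [holderRatio, holderRatio, ← ENNReal.ofReal_inv_of_pos (by positivity),
      ← ENNReal.ofReal_pow (by positivity), ← ENNReal.ofReal_ofNat 2,
      ← ENNReal.ofReal_mul (by positivity), ← ENNReal.ofReal_mul (by positivity)]
    congr 1
    rw [Real.rpow_neg (by norm_num) θ, inv_inv, ← Real.rpow_mul_natCast (by norm_num),
      ← Real.rpow_add_one (by norm_num), ← Real.rpow_add (by norm_num)]
    congr 1
    push_cast
    ring
  rw [h1, ENNReal.ofReal_lt_one]
  exact Real.rpow_lt_one_of_one_lt_of_neg one_lt_two (by linarith)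

section Kolmogorov

variable {Ω : Type*} [MeasurableSpace Ω] {P : Measure Ω} {Z : UnitTime → Ω → L2}

theorem aemeasurable_holderConstPow (hZ : ∀ t, AEStronglyMeasurable (Z t) P) (q : ℕ) (θ : ℝ) :
    AEMeasurable (fun ω => holderConstPow q θ fun t => Z t ω) P := by
  unfold holderConstPow
  refine AEMeasurable.tsum fun j => AEMeasurable.const_mul ?_ _
  refine Finset.aemeasurable_fun_sum _ fun i _ => AEMeasurable.pow_const ?_ _
  exact aemeasurable_spaceNorm ((hZ _).sub (hZ _)) q

theorem abs_gridPt_sub_eq {j i : ℕ} (hi : i < 2 ^ j) :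
    |((gridPt j (i + 1) : UnitTime) : ℝ) - (gridPt j i : UnitTime)| = (1 / 2) ^ j := by
  rw [coe_gridPt (by omega : i + 1 ≤ 2 ^ j), coe_gridPt hi.le, ← sub_div]
  push_cast
  rw [add_sub_cancel_left, abs_of_pos (by positivity), one_div_pow]

/-- The moment bound in the Kolmogorov criterion. -/
theorem lintegral_holderConstPow_le (hZ : ∀ t, AEStronglyMeasurable (Z t) P) {q : ℕ} {θ b : ℝ}
    {A : ℝ≥0∞} (hA : ∀ s t : UnitTime, ∫⁻ ω, spaceNorm q (Z t ω - Z s ω) ^ (2 * q) ∂P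
      ≤ A * ENNReal.ofReal (|(t : ℝ) - s| ^ b)) :
    ∫⁻ ω, holderConstPow q θ (fun t => Z t ω) ∂P ≤ A * kolmogorovConst q θ b := by
  have hm : ∀ j i, AEMeasurable (fun ω =>
      spaceNorm q (Z (gridPt j (i + 1)) ω - Z (gridPt j i) ω) ^ (2 * q)) P := fun j i =>
    AEMeasurable.pow_const (aemeasurable_spaceNorm ((hZ _).sub (hZ _)) q) _
  unfold holderConstPow
  rw [lintegral_tsum fun j => (Finset.aemeasurable_fun_sum _ fun i _ => hm j i).const_mul _,
    kolmogorovConst, ← ENNReal.tsum_geometric, ← ENNReal.tsum_mul_left]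
  refine ENNReal.tsum_le_tsum fun j => ?_
  rw [lintegral_const_mul'' _ (Finset.aemeasurable_fun_sum _ fun i _ => hm j i),
    lintegral_finsetSum' _ fun i _ => hm j i]
  have h1 : ∑ i ∈ Finset.range (2 ^ j), ∫⁻ ω,
      spaceNorm q (Z (gridPt j (i + 1)) ω - Z (gridPt j i) ω) ^ (2 * q) ∂P
      ≤ 2 ^ j * (A * holderRatio b ^ j) := by
    refine (Finset.sum_le_card_nsmul _ _ (A * holderRatio b ^ j) fun i hi => ?_).trans_eq ?_
    · refine (hA _ _).trans_eq ?_
      rw [abs_gridPt_sub_eq (Finset.mem_range.1 hi), holderRatio_pow]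
    · simp [nsmul_eq_mul]
  refine (mul_le_mul_right h1 _).trans_eq ?_
  rw [ENNReal.inv_pow, mul_pow, mul_pow, ← pow_mul, ← pow_mul, mul_comm j]
  ring

theorem spaceNorm_sub_le_of_continuous {q : ℕ} (hq : 1 ≤ q) {θ : ℝ} (hθ : 0 < θ)
    {z : UnitTime → L2} (hz : Continuous z) (s t : UnitTime) :
    spaceNorm q (z t - z s)
      ≤ chainConst θ * holderConst q θ z * ENNReal.ofReal (|(t : ℝ) - s| ^ θ) :=
  limit_holder_le hθ (spaceNorm_zero q) (spaceNorm_add_le hq) (spaceNorm_neg q)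
    (isClosed_spaceNorm_le q) (increment_le_holderConst hq θ z)
    (fun t => (hz.tendsto t).comp (tendsto_gridPt t)) s t

theorem tendsto_ofReal_abs_sub_rpow {θ : ℝ} (hθ : 0 < θ) (t : UnitTime) {c : ℝ≥0∞} (hc : c ≠ ∞) :
    Tendsto (fun s : UnitTime => c * ENNReal.ofReal (|(s : ℝ) - t| ^ θ)) (𝓝 t) (𝓝 0) := by
  have h1 : Continuous fun s : UnitTime => ENNReal.ofReal (|(s : ℝ) - t| ^ θ) := by
    refine ENNReal.continuous_ofReal.comp (Continuous.rpow_const ?_ fun _ => Or.inr hθ.le)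
    fun_prop
  have h2 := ENNReal.Tendsto.const_mul (a := c) (h1.tendsto t) (Or.inr hc)
  simpa [Real.zero_rpow hθ.ne'] using h2

/-- The Kolmogorov criterion: a process with small increments has a continuous modification. -/
theorem exists_continuous_modification (hZ : ∀ t, AEStronglyMeasurable (Z t) P) {q : ℕ}
    (hq : 1 ≤ q) {θ b : ℝ} (hθ : 0 < θ) (hb : 1 + 2 * q * θ < b) {A : ℝ≥0∞} (hAtop : A ≠ ∞)
    (hA : ∀ s t : UnitTime, ∫⁻ ω, spaceNorm q (Z t ω - Z s ω) ^ (2 * q) ∂P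
      ≤ A * ENNReal.ofReal (|(t : ℝ) - s| ^ b)) :
    ∃ Z' : UnitTime → Ω → L2, (∀ t, Z t =ᵐ[P] Z' t) ∧ ∀ ω, Continuous fun t => Z' t ω := by
  classical
  have hfin : ∀ᵐ ω ∂P, holderConst q θ (fun t => Z t ω) ≠ ∞ := by
    have h1 : ∫⁻ ω, holderConstPow q θ (fun t => Z t ω) ∂P ≠ ∞ :=
      ((lintegral_holderConstPow_le hZ hA).trans_lt
        (ENNReal.mul_lt_top hAtop.lt_top (kolmogorovConst_lt_top hb))).ne
    filter_upwards [ae_lt_top' (aemeasurable_holderConstPow hZ q θ) h1] with ω hω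
    exact ENNReal.rpow_ne_top_of_nonneg (by positivity) hω.ne
  have hlim : ∀ ω, holderConst q θ (fun t => Z t ω) ≠ ∞ → ∃ y : UnitTime → L2,
      ∀ t, Tendsto (fun j => Z (gridPt j (gridIdx j t)) ω) atTop (𝓝 (y t)) := by
    intro ω hω
    have hc : ∀ t, CauchySeq fun j => Z (gridPt j (gridIdx j t)) ω := fun t => by
      refine cauchySeq_of_edist_le_geometric (holderRatio θ)
        (holderConst q θ fun t => Z t ω) (holderRatio_lt_one hθ) hω fun j => ?_
      rw [edist_comm, edist_eq_enorm_sub]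
      refine (enorm_le_spaceNorm hq _).trans ?_
      refine (increment_gridIdx_succ_le (N := spaceNorm q) (f := fun t => Z t ω)
        (spaceNorm_zero q) (increment_le_holderConst hq θ fun t => Z t ω) j t).trans ?_
      exact mul_le_mul_right
        (pow_le_pow_right_of_le_one' (holderRatio_lt_one hθ).le (Nat.le_succ j)) _
    choose y hy using fun t => cauchySeq_tendsto_of_complete (hc t)
    exact ⟨y, hy⟩
  choose! y hy using hlim
  have hb0 : 0 < b := lt_of_le_of_lt (by positivity) hb
  refine ⟨fun t ω => if holderConst q θ (fun t => Z t ω) ≠ ∞ then y ω t else 0, fun t => ?_,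
    fun ω => ?_⟩
  · have hconv : ∀ᵐ ω ∂P, Tendsto (fun j => Z (gridPt j (gridIdx j t)) ω) atTop (𝓝 (y ω t)) := by
      filter_upwards [hfin] with ω hω using hy ω hω t
    have hym : AEStronglyMeasurable (fun ω => y ω t) P :=
      aestronglyMeasurable_of_tendsto_ae _ (fun j => hZ _) hconv
    -- The approximations from level J on lie within 2^(-J) of t, and Fatou passes to their limit.
    -- The first summand is zero because b > 0; J → ∞ removes the second, so y is a modification of
    -- Z.
    have hle : ∀ J : ℕ, ∫⁻ ω, spaceNorm q (y ω t - Z t ω) ^ (2 * q) ∂P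
        ≤ A * ENNReal.ofReal (|(t : ℝ) - t| ^ b) + A * ENNReal.ofReal (((1 / 2) ^ J) ^ b) := by
      intro J
      refine lintegral_spaceNorm_pow_le_of_tendsto
        (u := fun j ω => Z (gridPt (j + J) (gridIdx (j + J) t)) ω - Z t ω)
        (fun j => (hZ _).sub (hZ _)) ?_ fun j => ?_
      · filter_upwards [hconv] with ω hω
        exact ((tendsto_add_atTop_iff_nat J).2 hω).sub_const _
      · refine (hA _ _).trans (le_add_left ?_)
        gcongr
        refine (abs_gridPt_gridIdx_sub_le _ t).trans ?_
        exact pow_le_pow_of_le_one (by norm_num) (by norm_num) (by omega)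
    have hzero : ∫⁻ ω, spaceNorm q (y ω t - Z t ω) ^ (2 * q) ∂P = 0 := by
      refine le_antisymm (ge_of_tendsto' (f := fun J : ℕ => A * ENNReal.ofReal (|(t : ℝ) - t| ^ b)
        + A * ENNReal.ofReal (((1 / 2) ^ J) ^ b)) (x := atTop) ?_ hle) zero_le
      have h1 : Tendsto (fun J : ℕ => holderRatio b ^ J) atTop (𝓝 0) :=
        ENNReal.tendsto_pow_atTop_nhds_zero_of_lt_one (holderRatio_lt_one hb0)
      have h2 := ENNReal.Tendsto.const_mul (a := A) h1 (Or.inr hAtop)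
      simpa [holderRatio_pow, Real.zero_rpow hb0.ne'] using h2
    have hm : AEMeasurable (fun ω => spaceNorm q (y ω t - Z t ω) ^ (2 * q)) P :=
      (aemeasurable_spaceNorm (hym.sub (hZ t)) q).pow_const _
    rw [lintegral_eq_zero_iff' hm] at hzero
    filter_upwards [hzero, hfin] with ω h1 h2
    rw [if_pos h2]
    have h3 : spaceNorm q (y ω t - Z t ω) = 0 := by simpa [show q ≠ 0 by omega] using h1
    have h4 := le_antisymm ((enorm_le_spaceNorm hq _).trans_eq h3) zero_le
    rw [enorm_eq_zero, sub_eq_zero] at h4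
    exact h4.symm
  · by_cases hω : holderConst q θ (fun t => Z t ω) ≠ ∞
    · simp only [if_pos hω]
      refine continuous_iff_continuousAt.2 fun t => ?_
      rw [ContinuousAt, tendsto_iff_edist_tendsto_0]
      refine tendsto_of_tendsto_of_tendsto_of_le_of_le tendsto_const_nhds
        (tendsto_ofReal_abs_sub_rpow hθ t
          (ENNReal.mul_ne_top (chainConst_lt_top hθ).ne hω)) (fun _ => zero_le) fun s => ?_
      rw [edist_eq_enorm_sub]
      refine (enorm_le_spaceNorm hq _).trans ?_
      exact limit_holder_le (N := spaceNorm q) (f := fun t => Z t ω) hθ (spaceNorm_zero q)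
        (spaceNorm_add_le hq) (spaceNorm_neg q) (isClosed_spaceNorm_le q)
        (increment_le_holderConst hq θ fun t => Z t ω) (hy ω hω) t s
    · simp only [if_neg hω]
      exact continuous_const

end Kolmogorov

end HeatNoise

/-! ### Continuous versions of the noise, and almost sure Hölder convergence. -/

namespace HeatNoise

/-- The processes `X k` have at each time the structure required of the coefficients of a random
series, and their increments are of the order of Brownian increments. -/
structure IsRegularFamily {Ω : Type*} [MeasurableSpace Ω] (P : Measure Ω)
    (X : ℕ → UnitTime → Ω → ℝ) (C : ℕ → ℝ) : Prop where
  const_nonneg : ∀ j, 0 ≤ C j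
  increment : ∀ s t : UnitTime,
    IsIndepCentered P (fun k ω => X k t ω - X k s ω) C |(t : ℝ) - s|
  value : ∀ t, ∃ C' : ℕ → ℝ, (∀ j, 0 ≤ C' j) ∧ IsIndepCentered P (fun k => X k t) C' 1

section Regular

variable {Ω : Type*} [MeasurableSpace Ω] {P : Measure Ω} {lam : ℕ → ℝ}
  {X X' : ℕ → UnitTime → Ω → ℝ} {C : ℕ → ℝ} {V V' W : UnitTime → Ω → L2}

theorem IsRegularFamily.aemeasurable (hX : IsRegularFamily P X C) (k : ℕ) (t : UnitTime) :
    AEMeasurable (X k t) P := by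
  obtain ⟨C', -, h⟩ := hX.value t
  exact h.aemeasurable k

theorem IsNoise.congr (hV : IsNoise P lam X V) (h : ∀ t, V t =ᵐ[P] V' t) : IsNoise P lam X V' :=
  isNoise_iff.2 fun t => (isNoise_iff.1 hV t).congr (h t)

theorem ae_forall_eq_of_continuous (h : ∀ t, V t =ᵐ[P] W t)
    (hV : ∀ᵐ ω ∂P, Continuous fun t => V t ω) (hW : ∀ᵐ ω ∂P, Continuous fun t => W t ω) :
    ∀ᵐ ω ∂P, ∀ t, V t ω = W t ω := by
  obtain ⟨D, hDc, hD⟩ := TopologicalSpace.exists_countable_dense UnitTime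
  have h1 : ∀ᵐ ω ∂P, ∀ t ∈ D, V t ω = W t ω := (ae_ball_iff hDc).2 fun t _ => h t
  filter_upwards [h1, hV, hW] with ω h1 h2 h3 t
  exact congrFun (h2.ext_on hD h3 h1) t

/-- The relation holds almost surely at the countably many dyadic times; path continuity and the
closed graph extend it to all times. -/
theorem IsNoise.ae_isFracLaplacian {η : ℝ} {Z : UnitTime → Ω → L2}
    (hX : ∀ k t, AEMeasurable (X k t) P) (hlam : ∀ k, 0 ≤ lam k) (hV : IsNoise P lam X V)
    (hVc : ∀ᵐ ω ∂P, Continuous fun t => V t ω) (hZ : IsNoise P (fracWeight η lam) X Z)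
    (hZc : ∀ᵐ ω ∂P, Continuous fun t => Z t ω) :
    ∀ᵐ ω ∂P, ∀ t, IsFracLaplacian η (V t ω) (Z t ω) := by
  have h1 : ∀ᵐ ω ∂P, ∀ j i, IsFracLaplacian η (V (gridPt j i) ω) (Z (gridPt j i) ω) :=
    ae_all_iff.2 fun j => ae_all_iff.2 fun i =>
      (isNoise_iff.1 hV _).ae_isFracLaplacian hlam (fun k => hX k _) (isNoise_iff.1 hZ _)
  filter_upwards [h1, hVc, hZc] with ω h1 h2 h3 t
  exact isFracLaplacian_of_tendsto ((h2.tendsto t).comp (tendsto_gridPt t))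
    ((h3.tendsto t).comp (tendsto_gridPt t)) fun j => h1 j _

variable [IsProbabilityMeasure P]

theorem IsNoise.lintegral_increment_le (hlam : ∀ k, 0 ≤ lam k) (hsum : Summable lam)
    (hV : IsNoise P lam X V) (hC : ∀ j, 0 ≤ C j) {s t : UnitTime}
    (hX : ∀ k t, AEMeasurable (X k t) P) {h : ℝ}
    (hinc : IsIndepCentered P (fun k ω => X k t ω - X k s ω) C h) {q : ℕ} (hq : 1 ≤ q) :
    ∫⁻ ω, spaceNorm q (V t ω - V s ω) ^ (2 * q) ∂P
      ≤ ENNReal.ofReal (momentConst C q * (2 * ∑' k, lam k) ^ q * h ^ q) := by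
  refine (((isNoise_iff.1 hV t).sub (fun k => hX k t)
    (isNoise_iff.1 hV s)).lintegral_spaceNorm_le hinc hC hlam hsum hq).trans_eq ?_
  rw [mul_pow]
  ring_nf

theorem IsRegularFamily.lintegral_increment_le (hX : IsRegularFamily P X C)
    (hlam : ∀ k, 0 ≤ lam k) (hsum : Summable lam) (hV : IsNoise P lam X V) {q : ℕ} (hq : 1 ≤ q)
    (s t : UnitTime) :
    ∫⁻ ω, spaceNorm q (V t ω - V s ω) ^ (2 * q) ∂P
      ≤ ENNReal.ofReal (momentConst C q * (2 * ∑' k, lam k) ^ q)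
        * ENNReal.ofReal (|(t : ℝ) - s| ^ (q : ℝ)) := by
  refine (IsNoise.lintegral_increment_le hlam hsum hV hX.const_nonneg hX.aemeasurable
    (hX.increment s t) hq).trans_eq ?_
  have := momentConst_nonneg hX.const_nonneg q
  have : 0 ≤ ∑' k, lam k := tsum_nonneg hlam
  rw [ENNReal.ofReal_mul (by positivity), Real.rpow_natCast]

theorem IsRegularFamily.exists_continuous_noise (hX : IsRegularFamily P X C)
    (hlam : ∀ k, 0 ≤ lam k) (hsum : Summable lam) :
    ∃ V, IsNoise P lam X V ∧ ∀ ω, Continuous fun t => V t ω := by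
  have h1 : ∀ t, ∃ Y, IsSeriesSum P lam (fun k => X k t) Y := fun t => by
    obtain ⟨C', hC', h⟩ := hX.value t
    exact h.exists_isSeriesSum hC' hlam hsum
  choose V hV using h1
  have hV' : IsNoise P lam X V := isNoise_iff.2 hV
  -- With b = q and θ = 1/4 the criterion asks for 1 + q/2 < q, and q = 3 is the first integer
  -- allowed.
  obtain ⟨V', h2, h3⟩ := exists_continuous_modification (fun t => (hV t).1) (q := 3) (by norm_num)
    (θ := 1 / 4) (b := (3 : ℕ)) (by norm_num) (by norm_num) ENNReal.ofReal_ne_top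
    (hX.lintegral_increment_le hlam hsum hV' (by norm_num))
  exact ⟨V', hV'.congr h2, h3⟩

theorem IsRegularFamily.ae_holderConst_lt_top (hX : IsRegularFamily P X C)
    (hlam : ∀ k, 0 ≤ lam k) (hsum : Summable lam) (hV : IsNoise P lam X V) :
    ∀ᵐ ω ∂P, ∀ q : ℕ, 3 ≤ q → holderConst q (1 / 4) (fun t => V t ω) < ∞ := by
  refine ae_all_iff.2 fun q => ?_
  by_cases hq : 3 ≤ q
  swap
  · exact Eventually.of_forall fun _ h => absurd h hq
  have hq' : (3 : ℝ) ≤ q := by exact_mod_cast hq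
  have hVm : ∀ t, AEStronglyMeasurable (V t) P := fun t => (isNoise_iff.1 hV t).1
  have h1 : ∫⁻ ω, holderConstPow q (1 / 4) (fun t => V t ω) ∂P ≠ ∞ :=
    ((lintegral_holderConstPow_le hVm
      (hX.lintegral_increment_le hlam hsum hV (by omega : 1 ≤ q))).trans_lt
        (ENNReal.mul_lt_top ENNReal.ofReal_lt_top (kolmogorovConst_lt_top (by linarith)))).ne
  filter_upwards [ae_lt_top' (aemeasurable_holderConstPow hVm q _) h1] with ω hω _
  exact ENNReal.rpow_lt_top_of_nonneg (by positivity) hω.ne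

theorem IsRegularFamily.ae_spaceNorm_lt_top (hX : IsRegularFamily P X C)
    (hlam : ∀ k, 0 ≤ lam k) (hsum : Summable lam) (hV : IsNoise P lam X V) (t : UnitTime) :
    ∀ᵐ ω ∂P, ∀ q : ℕ, spaceNorm q (V t ω) < ∞ := by
  refine ae_all_iff.2 fun q => ?_
  obtain ⟨C', hC', h⟩ := hX.value t
  have h1 : ∫⁻ ω, spaceNorm (q + 1) (V t ω) ^ (2 * (q + 1)) ∂P ≠ ∞ :=
    (((isNoise_iff.1 hV t).lintegral_spaceNorm_le h hC' hlam hsum (by omega)).trans_lt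
      ENNReal.ofReal_lt_top).ne
  have hm := aemeasurable_spaceNorm (isNoise_iff.1 hV t).1 (q + 1)
  filter_upwards [ae_lt_top' (hm.pow_const _) h1] with ω hω
  refine (spaceNorm_mono (Nat.le_succ q) _).trans_lt ?_
  exact (ENNReal.pow_lt_top_iff.1 hω).resolve_right (by omega)

/-- A finite value at time 0 and a Hölder bound on z suffice. Small p reduce to max p 3, as (0,1)
has measure 1. -/
theorem isContinuousSobolevPath_of_isFracLaplacian {η : ℝ} {v z : UnitTime → L2}
    (h : ∀ t, IsFracLaplacian η (v t) (z t)) (hz : Continuous z)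
    (hH : ∀ q : ℕ, 3 ≤ q → holderConst q (1 / 4) z < ∞) (h0 : ∀ q : ℕ, spaceNorm q (z 0) < ∞)
    (p : ℕ) : IsContinuousSobolevPath η (2 * p : ℕ) v := by
  have h1 : ∀ s t, spaceNorm p (z s - z t) ≤ chainConst (1 / 4) * holderConst (max p 3) (1 / 4) z
      * ENNReal.ofReal (|(s : ℝ) - t| ^ (1 / 4 : ℝ)) := fun s t =>
    (spaceNorm_mono (le_max_left p 3) _).trans
      (spaceNorm_sub_le_of_continuous (by omega) (by norm_num) hz t s)
  have hc : chainConst (1 / 4) * holderConst (max p 3) (1 / 4) z < ∞ :=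
    ENNReal.mul_lt_top (chainConst_lt_top (by norm_num)) (hH _ (le_max_right _ _))
  refine ⟨fun t => ?_, fun t => ?_⟩
  · refine (sobolevNorm_le (h t) p).trans_lt ?_
    refine (spaceNorm_mono (le_max_left p 3) _).trans_lt ?_
    rw [← sub_add_cancel (z t) (z 0)]
    refine (spaceNorm_add_le (by omega) _ _).trans_lt (ENNReal.add_lt_top.2 ⟨?_, h0 _⟩)
    exact (spaceNorm_sub_le_of_continuous (by omega) (by norm_num) hz 0 t).trans_lt
      (ENNReal.mul_lt_top hc ENNReal.ofReal_lt_top)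
  · exact tendsto_of_tendsto_of_tendsto_of_le_of_le tendsto_const_nhds
      (tendsto_ofReal_abs_sub_rpow (by norm_num) t hc.ne) (fun _ => zero_le)
      fun s => (sobolevNorm_le ((h s).sub (h t)) p).trans (h1 s t)

/-- A regular family defines a noise with a version whose paths are continuous in all the Sobolev
spaces, together with the image `Z` of that version under `(-Δ)^η`. -/
theorem IsRegularFamily.exists_version (hX : IsRegularFamily P X C) {η : ℝ} (hlam : ∀ k, 0 ≤ lam k)
    (hsum : Summable lam) (hsum' : Summable (fracWeight η lam)) :
    ∃ V Z, IsNoise P lam X V ∧ IsNoise P (fracWeight η lam) X Z ∧ ∀ ω,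
      (Continuous fun t => V t ω) ∧ (Continuous fun t => Z t ω) ∧
      (∀ t, IsFracLaplacian η (V t ω) (Z t ω)) ∧
      ∀ p : ℕ, IsContinuousSobolevPath η (2 * p : ℕ) fun t => V t ω := by
  classical
  have hlam' := fracWeight_nonneg hlam η
  obtain ⟨V, hV, hVc⟩ := hX.exists_continuous_noise hlam hsum
  obtain ⟨Z, hZ, hZc⟩ := hX.exists_continuous_noise hlam' hsum'
  -- Setting both processes to 0 off this almost sure event gives the path properties for every ω.
  let G : Ω → Prop := fun ω => (∀ t, IsFracLaplacian η (V t ω) (Z t ω)) ∧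
    (∀ q : ℕ, 3 ≤ q → holderConst q (1 / 4) (fun t => Z t ω) < ∞) ∧
    ∀ q : ℕ, spaceNorm q (Z 0 ω) < ∞
  have hG : ∀ᵐ ω ∂P, G ω := by
    filter_upwards [hV.ae_isFracLaplacian hX.aemeasurable hlam (Eventually.of_forall hVc) hZ
      (Eventually.of_forall hZc), hX.ae_holderConst_lt_top hlam' hsum' hZ,
      hX.ae_spaceNorm_lt_top hlam' hsum' hZ 0] with ω h1 h2 h3 using ⟨h1, h2, h3⟩
  refine ⟨fun t ω => if G ω then V t ω else 0, fun t ω => if G ω then Z t ω else 0,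
    hV.congr fun t => ?_, hZ.congr fun t => ?_, fun ω => ?_⟩
  · filter_upwards [hG] with ω hω using (if_pos hω).symm
  · filter_upwards [hG] with ω hω using (if_pos hω).symm
  · by_cases hω : G ω
    · simp only [if_pos hω]
      exact ⟨hVc ω, hZc ω, hω.1,
        isContinuousSobolevPath_of_isFracLaplacian hω.1 (hZc ω) hω.2.1 hω.2.2⟩
    · simp only [if_neg hω]
      refine ⟨continuous_const, continuous_const, fun _ => isFracLaplacian_zero η, fun p =>
        ⟨fun _ => ?_, fun _ => ?_⟩⟩
      · exact (sobolevNorm_le (isFracLaplacian_zero η) p).trans_lt (by simp [spaceNorm_zero])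
      · have : sobolevNorm η (2 * p : ℕ) 0 = 0 :=
          le_antisymm ((sobolevNorm_le (isFracLaplacian_zero η) p).trans_eq (spaceNorm_zero p))
            zero_le
        simp only [sub_self, this]
        exact tendsto_const_nhds

theorem holderSeminorm_le {η θ θ' : ℝ} {v z : UnitTime → L2} {p q : ℕ} (hpq : p ≤ q) (hq : 1 ≤ q)
    (hθ' : 0 < θ') (hθ : θ ≤ θ') (h : ∀ t, IsFracLaplacian η (v t) (z t)) (hz : Continuous z) :
    holderSeminorm θ η (2 * p : ℕ) v ≤ chainConst θ' * holderConst q θ' z := by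
  refine iSup_le fun s => iSup_le fun t => iSup_le fun hst => ?_
  have hst' : (s : ℝ) < t := by exact_mod_cast hst
  have ht1 : (t : ℝ) ≤ 1 := by exact_mod_cast t.2.2
  have hs0 : (0 : ℝ) ≤ s := NNReal.coe_nonneg _
  refine ENNReal.div_le_of_le_mul ?_
  refine (sobolevNorm_le ((h t).sub (h s)) p).trans ((spaceNorm_mono hpq _).trans ?_)
  refine (spaceNorm_sub_le_of_continuous hq hθ' hz s t).trans ?_
  rw [abs_of_pos (sub_pos.2 hst')]
  exact mul_le_mul_right (ENNReal.ofReal_le_ofReal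
    (Real.rpow_le_rpow_of_exponent_ge (sub_pos.2 hst') (by linarith) hθ)) _

/-- Interpolation between the two scales of the difference process: a is the time lag and r the rate
of approximation. -/
theorem min_pow_le {a r δ : ℝ} (ha : 0 ≤ a) (hr : 0 < r) (hδ : 0 ≤ δ) (hδ1 : δ < 1) (q : ℕ) :
    min a r ^ q ≤ r ^ (δ * q) * a ^ ((1 - δ) * q) := by
  have hm : 0 ≤ min a r := le_min ha hr.le
  have h1 : 0 ≤ δ * q := by positivity
  have h2 : 0 ≤ (1 - δ) * q := mul_nonneg (by linarith) (by positivity)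
  calc min a r ^ q = min a r ^ (δ * q + (1 - δ) * q) := by
        rw [← Real.rpow_natCast]
        congr 1
        ring
    _ = min a r ^ (δ * q) * min a r ^ ((1 - δ) * q) :=
        Real.rpow_add_of_nonneg hm h1 h2
    _ ≤ _ := mul_le_mul (Real.rpow_le_rpow hm (min_le_right _ _) h1)
        (Real.rpow_le_rpow hm (min_le_left _ _) h2) (by positivity) (by positivity)

/-- Almost sure convergence in Hölder norm for noises whose coefficients converge polynomially
fast. -/
theorem ae_tendsto_holderConst (hlam : ∀ k, 0 ≤ lam k) (hsum : Summable lam)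
    (hC : ∀ j, 0 ≤ C j) {ν : ℝ} {Y : ℕ → ℕ → UnitTime → Ω → ℝ}
    (hYm : ∀ n k t, AEMeasurable (Y n k t) P)
    (hY : ∀ n, ∀ s t : UnitTime, IsIndepCentered P (fun k ω => Y n k t ω - Y n k s ω) C
      (min |(t : ℝ) - s| (((n + 1 : ℕ) : ℝ) ^ (-ν))))
    {D : ℕ → UnitTime → Ω → L2} (hD : ∀ n, IsNoise P lam (Y n) (D n)) {θ : ℝ}
    {q : ℕ} (hq : 1 ≤ q) {δ : ℝ} (hδ : 0 < δ) (hδ1 : δ < 1) (hqθ : 1 + 2 * q * θ < (1 - δ) * q)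
    (hqν : 1 < ν * (δ * q)) :
    ∀ᵐ ω ∂P, Tendsto (fun n => holderConst q θ fun t => D n t ω) atTop (𝓝 0) := by
  set M := momentConst C q * (2 * ∑' k, lam k) ^ q with hM
  have hM0 : 0 ≤ M := by
    have := momentConst_nonneg hC q
    have : 0 ≤ ∑' k, lam k := tsum_nonneg hlam
    positivity
  have hDm : ∀ n t, AEStronglyMeasurable (D n t) P := fun n t => (isNoise_iff.1 (hD n) t).1
  have h1 : ∀ n, ∀ s t : UnitTime, ∫⁻ ω, spaceNorm q (D n t ω - D n s ω) ^ (2 * q) ∂P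
      ≤ ENNReal.ofReal (M * ((n + 1 : ℕ) : ℝ) ^ (-(ν * (δ * q))))
        * ENNReal.ofReal (|(t : ℝ) - s| ^ ((1 - δ) * q)) := by
    intro n s t
    refine ((hD n).lintegral_increment_le hlam hsum hC (hYm n) (hY n s t) hq).trans ?_
    rw [← ENNReal.ofReal_mul (by positivity), ← hM, mul_assoc M]
    refine ENNReal.ofReal_le_ofReal (mul_le_mul_of_nonneg_left ?_ hM0)
    refine (min_pow_le (abs_nonneg _) (by positivity) hδ.le hδ1 q).trans_eq ?_
    rw [← Real.rpow_mul (by positivity), neg_mul]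
  -- Finite expectation of the sum makes the sum almost surely finite, so its terms tend to 0.
  have h2 : ∫⁻ ω, ∑' n, holderConstPow q θ (fun t => D n t ω) ∂P ≠ ∞ := by
    rw [lintegral_tsum fun n => aemeasurable_holderConstPow (hDm n) q θ]
    refine ((ENNReal.tsum_le_tsum fun n =>
      lintegral_holderConstPow_le (hDm n) (h1 n)).trans_lt ?_).ne
    rw [ENNReal.tsum_mul_right]
    refine ENNReal.mul_lt_top ?_ (kolmogorovConst_lt_top hqθ)
    have hs : Summable fun n : ℕ => M * ((n + 1 : ℕ) : ℝ) ^ (-(ν * (δ * q))) := by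
      refine Summable.mul_left _ ?_
      exact (summable_nat_add_iff 1).2 (Real.summable_nat_rpow.2 (by linarith))
    rw [← ENNReal.ofReal_tsum_of_nonneg (fun n => by positivity) hs]
    exact ENNReal.ofReal_lt_top
  filter_upwards [ae_lt_top' (AEMeasurable.tsum fun n =>
    aemeasurable_holderConstPow (hDm n) q θ) h2] with ω hω
  have h3 := ENNReal.tendsto_atTop_zero_of_tsum_ne_top hω.ne
  have h4 := h3.ennrpow_const ((2 * q : ℕ) : ℝ)⁻¹
  rwa [ENNReal.zero_rpow_of_pos (by positivity)] at h4

end Regular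

end HeatNoise

/-! ### Scalar moments and their transfer to independent copies. -/

namespace HeatNoise

section Moments

variable {Ω : Type*} [MeasurableSpace Ω] {P : Measure Ω}

theorem memLp_of_lintegral_even_pow_lt_top [IsFiniteMeasure P] {f : Ω → ℝ}
    (hf : AEMeasurable f P) (h : ∀ p : ℕ, 1 ≤ p → ∫⁻ ω, ‖f ω‖ₑ ^ (2 * p) ∂P < ∞) (n : ℕ) :
    MemLp f n P := by
  have h1 : MemLp f (2 * (n + 1) : ℕ) P := by
    refine ⟨hf.aestronglyMeasurable, ?_⟩
    rw [eLpNorm_lt_top_iff_lintegral_rpow_enorm_lt_top (by simp) (ENNReal.natCast_ne_top _)]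
    simpa only [ENNReal.toReal_natCast, ENNReal.rpow_natCast] using h (n + 1) (by omega)
  exact h1.mono_exponent (by exact_mod_cast (by omega : n ≤ 2 * (n + 1)))

/-- The absolute value is there because the constants in the hypotheses carry no sign, while the
moment induction needs nonnegative ones. -/
theorem integral_even_pow_le_abs [IsFiniteMeasure P] {f : Ω → ℝ} {p : ℕ}
    (hf : MemLp f (2 * p : ℕ) P) {B : ℝ}
    (h : ∫⁻ ω, ‖f ω‖ₑ ^ (2 * p) ∂P ≤ ENNReal.ofReal B) : ∫ ω, f ω ^ (2 * p) ∂P ≤ |B| := by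
  rw [lintegral_enorm_pow_eq hf] at h
  exact (ENNReal.ofReal_le_ofReal_iff (abs_nonneg B)).1
    (h.trans (ENNReal.ofReal_le_ofReal (le_abs_self B)))

theorem integral_sub_even_pow_le [IsFiniteMeasure P] {f g : Ω → ℝ} {p : ℕ}
    (hf : MemLp f (2 * p : ℕ) P) (hg : MemLp g (2 * p : ℕ) P) :
    ∫ ω, (f ω - g ω) ^ (2 * p) ∂P
      ≤ 4 ^ p * (∫ ω, f ω ^ (2 * p) ∂P + ∫ ω, g ω ^ (2 * p) ∂P) := by
  have hf' := integrable_pow_of_memLp hf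
  have hg' := integrable_pow_of_memLp hg
  rw [← integral_add hf' hg', ← integral_const_mul]
  refine integral_mono (integrable_pow_of_memLp (hf.sub hg)) ((hf'.add hg').const_mul _)
    fun ω => ?_
  have he := even_two_mul p
  have h1 := he.add_pow_le (a := f ω) (b := -g ω)
  rw [he.neg_pow, ← sub_eq_add_neg] at h1
  refine h1.trans ?_
  have h2 : (2 : ℝ) ^ (2 * p - 1) ≤ 4 ^ p := by
    rw [show (4 : ℝ) = 2 ^ 2 by norm_num, ← pow_mul]
    exact pow_le_pow_right₀ one_le_two (Nat.sub_le _ _)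
  exact mul_le_mul_of_nonneg_right h2 (add_nonneg (he.pow_nonneg _) (he.pow_nonneg _))

theorem integral_even_pow_gaussianReal (v : ℝ≥0) (p : ℕ) :
    ∫ x, x ^ (2 * p) ∂gaussianReal 0 v = (∫ x, x ^ (2 * p) ∂gaussianReal 0 1) * (v : ℝ) ^ p := by
  have h1 : gaussianReal 0 v = (gaussianReal 0 1).map (√(v : ℝ) * ·) := by
    rw [gaussianReal_map_const_mul, mul_zero, mul_one]
    congr 1
    ext
    exact (Real.sq_sqrt v.2).symm
  rw [h1, integral_map (by fun_prop) (by fun_prop)]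
  simp_rw [mul_pow]
  rw [integral_const_mul, pow_mul, Real.sq_sqrt (NNReal.coe_nonneg v), mul_comm]

end Moments

section Copies

variable {Ω Ω' T : Type*} [MeasurableSpace Ω] [MeasurableSpace Ω'] [MeasurableSpace T]
  {P : Measure Ω} {P' : Measure Ω'} {Φ : ℕ → Ω' → T} {φ : Ω → T}

/-- Independence and moments pass through a measurable functional u of whole paths, so increments,
values and differences are all covered by the choice of u. -/
theorem isIndepCentered_of_copies (hcopy : ∀ k, IdentDistrib (Φ k) φ P' P)
    (hind : iIndepFun Φ P') {u : T → ℝ} (hu : Measurable u)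
    (hL : ∀ n : ℕ, MemLp (fun ω => u (φ ω)) n P) (h0 : ∫ ω, u (φ ω) ∂P = 0)
    {C : ℕ → ℝ} {h : ℝ} (hh : 0 ≤ h)
    (hm : ∀ j, 1 ≤ j → ∫ ω, u (φ ω) ^ (2 * j) ∂P ≤ C j * h ^ j) :
    IsIndepCentered P' (fun k ω => u (Φ k ω)) C h where
  indep := hind.comp (fun _ => u) (fun _ => hu)
  memLp k n := ((hcopy k).comp hu).memLp_iff.2 (hL n)
  integral_eq_zero k := ((hcopy k).comp hu).integral_eq.trans h0
  scale_nonneg := hh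
  moment_le k j hj := ((hcopy k).comp (hu.pow_const (2 * j))).integral_eq.trans_le (hm j hj)

theorem isRegularFamily_of_copies (hcopy : ∀ k, IdentDistrib (Φ k) φ P' P)
    (hind : iIndepFun Φ P') {g : UnitTime → T → ℝ} (hg : ∀ t, Measurable (g t))
    (hL : ∀ t, ∀ n : ℕ, MemLp (fun ω => g t (φ ω)) n P) (h0 : ∀ t, ∫ ω, g t (φ ω) ∂P = 0)
    [IsFiniteMeasure P] {C : ℕ → ℝ} (hC : ∀ j, 0 ≤ C j)
    (hm : ∀ s t : UnitTime, ∀ j, 1 ≤ j →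
      ∫ ω, (g t (φ ω) - g s (φ ω)) ^ (2 * j) ∂P ≤ C j * |(t : ℝ) - s| ^ j) :
    IsRegularFamily P' (fun k t ω => g t (Φ k ω)) C where
  const_nonneg := hC
  increment s t := by
    have hi : ∀ t, Integrable (fun ω => g t (φ ω)) P := fun t =>
      memLp_one_iff_integrable.1 (by simpa using hL t 1)
    refine isIndepCentered_of_copies (u := fun x => g t x - g s x) hcopy hind
      ((hg t).sub (hg s)) (fun n => (hL t n).sub (hL s n)) ?_ (abs_nonneg _) (hm s t)
    rw [integral_sub (hi t) (hi s), h0, h0, sub_zero]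
  value t := by
    -- No uniformity in t is needed, so the moments themselves serve as constants, at scale 1.
    refine ⟨fun j => ∫ ω, g t (φ ω) ^ (2 * j) ∂P,
      fun j => integral_nonneg fun ω => (even_two_mul j).pow_nonneg _,
      isIndepCentered_of_copies hcopy hind (hg t) (hL t) (h0 t) zero_le_one fun j _ => ?_⟩
    simp

end Copies

end HeatNoise

/-! ### The main theorem. -/

theorem proposition4p4
    -- the weights and the spatial regularity
    (lam : ℕ → ℝ) (η : ℝ) (hlam : ∀ k, 0 ≤ lam k) (hη : 0 < η)
    (hsum : Summable fun k : ℕ => lam k * ((k : ℝ) + 1) ^ (4 * η))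
    -- the processes `βⁿ`, `n ≥ 1`, and the Brownian motion `β`
    {Ω : Type*} [MeasurableSpace Ω] (P : Measure Ω) [IsProbabilityMeasure P]
    (βn : ℕ → HeatNoise.UnitTime → Ω → ℝ) (β : ℝ≥0 → Ω → ℝ)
    (hβ : IsBrownianReal β P)
    (hmeas : ∀ n, 1 ≤ n → ∀ t, AEMeasurable (βn n t) P)
    (hcent : ∀ n, 1 ≤ n → ∀ t, ∫ ω, βn n t ω ∂P = 0)
    (hincr : ∀ p : ℕ, 1 ≤ p → ∃ C : ℝ, ∀ s t : HeatNoise.UnitTime, ∀ n : ℕ, 1 ≤ n →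
      (∫⁻ ω, ‖βn n t ω - βn n s ω‖ₑ ^ (2 * p) ∂P)
        ≤ ENNReal.ofReal (C * |(t : ℝ) - (s : ℝ)| ^ p))
    (ν : ℝ) (hν : 0 < ν)
    (happrox : ∀ p : ℕ, 1 ≤ p → ∃ C : ℝ, ∀ n : ℕ, 1 ≤ n →
      (⨆ t : HeatNoise.UnitTime, ∫⁻ ω, ‖βn n t ω - β t ω‖ₑ ^ (2 * p) ∂P)
        ≤ ENNReal.ofReal (C * (n : ℝ) ^ (-(ν * p))))
    -- the independent copies, possibly on another probability space
    {Ω' : Type*} [MeasurableSpace Ω'] (P' : Measure Ω') [IsProbabilityMeasure P']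
    (βnk : ℕ → ℕ → HeatNoise.UnitTime → Ω' → ℝ) (βk : ℕ → HeatNoise.UnitTime → Ω' → ℝ)
    (hcopy : ∀ n, 1 ≤ n → ∀ k,
      IdentDistrib (fun ω' (t : HeatNoise.UnitTime) => (βnk n k t ω', βk k t ω'))
        (fun ω (t : HeatNoise.UnitTime) => (βn n t ω, β t ω)) P' P)
    (hindep : ∀ n, 1 ≤ n →
      iIndepFun (fun k ω' (t : HeatNoise.UnitTime) => (βnk n k t ω', βk k t ω')) P') :
    -- the processes have versions with continuous paths in all the Sobolev spaces
    (∀ n, 1 ≤ n → ∃ V : HeatNoise.UnitTime → Ω' → HeatNoise.L2,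
      HeatNoise.IsNoise P' lam (βnk n) V ∧
      ∀ ω', (Continuous fun t => V t ω') ∧ ∀ p : ℕ, 1 ≤ p →
        HeatNoise.IsContinuousSobolevPath η (2 * p : ℕ) fun t => V t ω') ∧
    (∃ W : HeatNoise.UnitTime → Ω' → HeatNoise.L2,
      HeatNoise.IsNoise P' lam βk W ∧
      ∀ ω', (Continuous fun t => W t ω') ∧ ∀ p : ℕ, 1 ≤ p →
        HeatNoise.IsContinuousSobolevPath η (2 * p : ℕ) fun t => W t ω') ∧
    -- all continuous versions converge
    ∀ (V : ℕ → HeatNoise.UnitTime → Ω' → HeatNoise.L2)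
      (W : HeatNoise.UnitTime → Ω' → HeatNoise.L2),
      (∀ n, 1 ≤ n → HeatNoise.IsNoise P' lam (βnk n) (V n) ∧
        ∀ᵐ ω' ∂P', Continuous fun t => V n t ω') →
      (HeatNoise.IsNoise P' lam βk W ∧ ∀ᵐ ω' ∂P', Continuous fun t => W t ω') →
      ∀ p : ℕ, 1 ≤ p → ∀ ε : ℝ, 0 < ε →
        ∀ᵐ ω' ∂P', Tendsto
          (fun n : ℕ => HeatNoise.holderSeminorm (1 / 2 - ε) η (2 * p : ℕ)
            fun t => V n t ω' - W t ω')
          atTop (𝓝 0) := by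

  open HeatNoise in
  have hsum0 := summable_of_summable_mul_rpow hlam hη hsum
  have hsum' := summable_fracWeight hsum
  have hlam' := fracWeight_nonneg hlam η
  have hβL : ∀ t : UnitTime, ∀ m : ℕ, MemLp (fun ω => β t ω) m P := fun t m => by
    have h1 := memLp_id_gaussianReal' (μ := 0) (v := t) m (ENNReal.natCast_ne_top m)
    rw [← (hβ.hasLaw_eval t).map_eq] at h1
    exact (memLp_map_measure_iff aestronglyMeasurable_id (hβ.aemeasurable t)).1 h1
  have hβ0 : ∀ t : UnitTime, ∫ ω, β t ω ∂P = 0 := fun t => hβ.integral_eval t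
  set Cg : ℕ → ℝ := fun j => ∫ x, x ^ (2 * j) ∂gaussianReal 0 1 with hCg
  have hCg0 : ∀ j, 0 ≤ Cg j := fun j => integral_nonneg fun x => (even_two_mul j).pow_nonneg _
  have hβm : ∀ (s t : UnitTime) (j : ℕ),
      ∫ ω, (β t ω - β s ω) ^ (2 * j) ∂P = Cg j * |(t : ℝ) - s| ^ j := fun s t j => by
    have h1 := (hβ.hasLaw_sub t s).integral_comp (f := fun x => x ^ (2 * j)) (by fun_prop)
    refine h1.trans ?_
    rw [integral_even_pow_gaussianReal, coe_nndist, Real.dist_eq]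
    rfl
  choose! Cn hCn using hincr
  choose! Ca hCa using happrox
  have hCa' : ∀ p, 1 ≤ p → ∀ n, 1 ≤ n → ∀ t : UnitTime,
      ∫⁻ ω, ‖βn n t ω - β t ω‖ₑ ^ (2 * p) ∂P ≤ ENNReal.ofReal (Ca p * (n : ℝ) ^ (-(ν * p))) :=
    fun p hp n hn t => (le_iSup (fun t : UnitTime =>
      ∫⁻ ω, ‖βn n t ω - β t ω‖ₑ ^ (2 * p) ∂P) t).trans (hCa p hp n hn)
  have hdL : ∀ n, 1 ≤ n → ∀ t : UnitTime, ∀ m : ℕ, MemLp (fun ω => βn n t ω - β t ω) m P :=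
    fun n hn t => memLp_of_lintegral_even_pow_lt_top ((hmeas n hn t).sub (hβ.aemeasurable t))
      fun p hp => (hCa' p hp n hn t).trans_lt ENNReal.ofReal_lt_top
  -- The increment hypothesis says nothing about values at a fixed time; integrability comes from βⁿ
  -- = (βⁿ - β) + β.
  have hnL : ∀ n, 1 ≤ n → ∀ t : UnitTime, ∀ m : ℕ, MemLp (fun ω => βn n t ω) m P :=
    fun n hn t m => by
      convert (hdL n hn t m).add (hβL t m) using 1
      ext ω
      simp
  have hnm : ∀ n, 1 ≤ n → ∀ (s t : UnitTime) (j : ℕ), 1 ≤ j →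
      ∫ ω, (βn n t ω - βn n s ω) ^ (2 * j) ∂P ≤ |Cn j| * |(t : ℝ) - s| ^ j := by
    intro n hn s t j hj
    refine (integral_even_pow_le_abs ((hnL n hn t _).sub (hnL n hn s _))
      (hCn j hj s t n hn)).trans_eq ?_
    rw [abs_mul, abs_pow, abs_abs]
  have hdm : ∀ n, 1 ≤ n → ∀ (t : UnitTime) (j : ℕ), 1 ≤ j →
      ∫ ω, (βn n t ω - β t ω) ^ (2 * j) ∂P ≤ |Ca j| * ((n : ℝ) ^ (-ν)) ^ j := by
    intro n hn t j hj
    refine (integral_even_pow_le_abs (hdL n hn t _) (hCa' j hj n hn t)).trans_eq ?_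
    rw [abs_mul, abs_of_nonneg (by positivity : 0 ≤ (n : ℝ) ^ (-(ν * j))), ← neg_mul,
      Real.rpow_mul_natCast (Nat.cast_nonneg n)]
  have hregn : ∀ n, 1 ≤ n → IsRegularFamily P' (βnk n) fun j => |Cn j| := fun n hn =>
    isRegularFamily_of_copies (g := fun t x => (x t).1) (hcopy n hn) (hindep n hn)
      (fun t => (measurable_pi_apply t).fst) (hnL n hn) (hcent n hn) (fun j => abs_nonneg _)
      (hnm n hn)
  -- The copies of β do not depend on n, so the pairs with n = 1 already determine their joint law.
  have hreg : IsRegularFamily P' βk Cg :=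
    isRegularFamily_of_copies (g := fun t x => (x t).2) (hcopy 1 le_rfl) (hindep 1 le_rfl)
      (fun t => (measurable_pi_apply t).snd) hβL hβ0 hCg0 fun s t j _ => (hβm s t j).le
  set C : ℕ → ℝ := fun j => 4 ^ j * (|Cn j| + Cg j + 2 * |Ca j|) with hC
  have hC0 : ∀ j, 0 ≤ C j := fun j => by
    have := hCg0 j
    positivity
  have hdiff : ∀ n : ℕ, ∀ s t : UnitTime, IsIndepCentered P'
      (fun k ω => (βnk (n + 1) k t ω - βk k t ω) - (βnk (n + 1) k s ω - βk k s ω)) C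
      (min |(t : ℝ) - s| (((n + 1 : ℕ) : ℝ) ^ (-ν))) := by
    intro n s t
    have hn : 1 ≤ n + 1 := Nat.le_add_left 1 n
    have hi : ∀ t, Integrable (fun ω => βn (n + 1) t ω - β t ω) P := fun t =>
      memLp_one_iff_integrable.1 (by simpa using hdL _ hn t 1)
    have hi0 : ∀ t, ∫ ω, (βn (n + 1) t ω - β t ω) ∂P = 0 := fun t => by
      rw [integral_sub (memLp_one_iff_integrable.1 (by simpa using hnL _ hn t 1))
        (memLp_one_iff_integrable.1 (by simpa using hβL t 1)), hcent _ hn, hβ0, sub_zero]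
    refine isIndepCentered_of_copies
      (u := fun x => ((x t).1 - (x t).2) - ((x s).1 - (x s).2)) (hcopy _ hn) (hindep _ hn)
      (by fun_prop) (fun m => (hdL _ hn t m).sub (hdL _ hn s m)) ?_
      (le_min (abs_nonneg _) (by positivity)) fun j hj => ?_
    · simp only
      rw [integral_sub (hi t) (hi s), hi0, hi0, sub_zero]
    · have hg := hCg0 j
      -- If the time lag is the minimum, the terms are regrouped as increments of βⁿ and of β;
      -- otherwise as approximation errors at t and at s.
      rcases min_choice |(t : ℝ) - s| (((n + 1 : ℕ) : ℝ) ^ (-ν)) with h | h <;> rw [h]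
      · have h1 : ∀ ω, βn (n + 1) t ω - β t ω - (βn (n + 1) s ω - β s ω)
            = (βn (n + 1) t ω - βn (n + 1) s ω) - (β t ω - β s ω) := fun ω => by ring
        simp only [h1]
        refine (integral_sub_even_pow_le ((hnL _ hn t _).sub (hnL _ hn s _))
          ((hβL t _).sub (hβL s _))).trans ?_
        rw [hC, mul_assoc]
        refine mul_le_mul_of_nonneg_left ?_ (by positivity)
        have h2 := hnm _ hn s t j hj
        have h3 := hβm s t j
        have h4 : 0 ≤ 2 * |Ca j| * |(t : ℝ) - s| ^ j := by positivity
        simp only [Pi.sub_apply]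
        linarith
      · refine (integral_sub_even_pow_le (hdL _ hn t _) (hdL _ hn s _)).trans ?_
        rw [hC, mul_assoc]
        refine mul_le_mul_of_nonneg_left ?_ (by positivity)
        have h2 := hdm _ hn t j hj
        have h3 := hdm _ hn s j hj
        have h4 : 0 ≤ (|Cn j| + Cg j) * (((n + 1 : ℕ) : ℝ) ^ (-ν)) ^ j := by positivity
        linarith
  obtain ⟨W', ZW, hW', hZW, hWpath⟩ := hreg.exists_version hlam hsum0 hsum'
  have hversion := fun n hn => (hregn n hn).exists_version hlam hsum0 hsum'
  refine ⟨fun n hn => ?_, ⟨W', hW', fun ω => ⟨(hWpath ω).1, fun p _ => (hWpath ω).2.2.2 p⟩⟩, ?_⟩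
  · obtain ⟨V', ZV, hV', -, hVpath⟩ := hversion n hn
    exact ⟨V', hV', fun ω => ⟨(hVpath ω).1, fun p _ => (hVpath ω).2.2.2 p⟩⟩
  intro V W hV hW p hp ε hε
  choose V' ZV hV' hZV hVpath using fun n : ℕ => hversion (n + 1) (Nat.le_add_left 1 n)
  have hYm : ∀ n k t, AEMeasurable (fun ω => βnk (n + 1) k t ω - βk k t ω) P' := fun n k t =>
    ((hregn (n + 1) (Nat.le_add_left 1 n)).aemeasurable k t).sub (hreg.aemeasurable k t)
  have hD : ∀ n, IsNoise P' (fracWeight η lam) (fun k t ω => βnk (n + 1) k t ω - βk k t ω)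
      (fun t ω => ZV n t ω - ZW t ω) := fun n => isNoise_iff.2 fun t =>
    (isNoise_iff.1 (hZV n) t).sub
      (fun k => (hregn (n + 1) (Nat.le_add_left 1 n)).aemeasurable k t) (isNoise_iff.1 hZW t)
  -- Chaining needs a positive exponent, while 1/2 - ε may be nonpositive; on a unit interval a
  -- larger exponent gives a stronger bound.
  set θ := max (1 / 2 - ε) (1 / 4) with hθ
  have hθ1 : θ < 1 / 2 := max_lt (by linarith) (by norm_num)
  have hθ2 : 1 / 4 ≤ θ := le_max_right _ _
  -- With this choice 1 + 2qθ < (1 - δ)q becomes 1 < qδ, and summability in n becomes 1 < qνδ.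
  set δ := 1 / 2 - θ with hδ
  have hδ0 : 0 < δ := by linarith
  obtain ⟨N, hN⟩ := exists_nat_gt (max (1 / δ) (1 / (ν * δ)))
  obtain ⟨hN1, hN2⟩ := max_lt_iff.1 hN
  set q := max p N with hq
  have hNq : (N : ℝ) ≤ q := by exact_mod_cast le_max_right p N
  have hq1 : 1 < q * δ := (div_lt_iff₀ hδ0).1 (hN1.trans_le hNq)
  have hq2 : 1 < q * (ν * δ) := (div_lt_iff₀ (by positivity)).1 (hN2.trans_le hNq)
  have hqp : p ≤ q := le_max_left p N
  have hlim := ae_tendsto_holderConst hlam' hsum' hC0 hYm hdiff hD (θ := θ) (hp.trans hqp) hδ0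
    (by linarith) (by nlinarith) (by linarith)
  have hVV : ∀ᵐ ω ∂P', ∀ n t, V (n + 1) t ω = V' n t ω := ae_all_iff.2 fun n => by
    have hn : 1 ≤ n + 1 := Nat.le_add_left 1 n
    refine ae_forall_eq_of_continuous (fun t => ?_) (hV (n + 1) hn).2
      (Eventually.of_forall fun ω => (hVpath n ω).1)
    exact (isNoise_iff.1 (hV (n + 1) hn).1 t).ae_eq
      (fun k => (hregn (n + 1) hn).aemeasurable k t) (isNoise_iff.1 (hV' n) t)
  have hWW : ∀ᵐ ω ∂P', ∀ t, W t ω = W' t ω :=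
    ae_forall_eq_of_continuous (fun t => (isNoise_iff.1 hW.1 t).ae_eq
      (fun k => hreg.aemeasurable k t) (isNoise_iff.1 hW' t)) hW.2
      (Eventually.of_forall fun ω => (hWpath ω).1)
  filter_upwards [hlim, hVV, hWW] with ω h1 h2 h3
  rw [← tendsto_add_atTop_iff_nat 1]
  have hc := (chainConst_lt_top (by linarith : 0 < θ)).ne
  have h4 := ENNReal.Tendsto.const_mul (a := chainConst θ) h1 (Or.inr hc)
  rw [mul_zero] at h4
  refine tendsto_of_tendsto_of_tendsto_of_le_of_le tendsto_const_nhds h4 (fun _ => zero_le)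
    fun n => ?_
  refine holderSeminorm_le hqp (hp.trans hqp) (by linarith) (le_max_left _ _) (fun t => ?_)
    ((hVpath n ω).2.1.sub (hWpath ω).2.1)
  rw [h2, h3]
  exact ((hVpath n ω).2.2.1 t).sub ((hWpath ω).2.2.1 t)
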